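/- Let $\pi:\mathcal X\to B$ be a differentiable family of $n$-dimensional compact complex manifolds over a domain $B\subseteq\mathbb R^m$ with $0\in B$: $\mathcal X$ is a smooth manifold, $\pi$ is a smooth surjective submersion with compact connected fibres $X_t=\pi^{-1}(t)$, and $\mathcal X$ has a locally finite open covering $\{\mathcal U_j\}$ with smooth functions $\zeta_j=(\zeta_j^1,\dots,\zeta_j^n):\mathcal U_j\to\mathbb C^n$ such that $(\zeta_j,\pi)$ are local charts of $\mathcal X$ and, for each $t$, the restrictions $\zeta_j|_{X_t}$ are holomorphically compatible and are the holomorphic coordinates of $X_t$. Fix a diffeomorphism $X\times B\cong\mathcal X$ over $B$ such that $X\times\{0\}\to X_0$ is biholomorphic for a compact complex manifold $X$ (so $X=X_0$). For fixed $t$ the $\zeta=\zeta_j$ thus become functions $\zeta(z,t)$ of the local holomorphic coordinates $z$ of $X_0$, forms on $X_t$ become forms on $X$, and $\bar\partial_t$ denotes the $\bar\partial$-operator of the complex structure of $X_t$, while $\partial,\bar\partial$ are the operators of $X_0$. Let $$\varphi=\varphi(t)=\varphi^i_{\bar j}\,d\bar z^j\otimes\frac{\partial}{\partial z^i},\qquad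 (\varphi^i_{\bar j})=\Big(\frac{\partial\zeta}{\partial z}\Big)^{-1}\frac{\partial\zeta}{\partial\bar z},$$ be the (integrable) Beltrami differential of the family, with conjugate $\bar\varphi=\overline{\varphi^i_{\bar j}}\,dz^j\otimes\frac{\partial}{\partial\bar z^i}$ and $\bar\varphi\varphi=\overline{\varphi^i_{\bar k}}\varphi^k_{\bar j}\,d\bar z^j\otimes\frac{\partial}{\partial\bar z^i}$. Let $i_\varphi$ be the contraction with $\varphi$, given by $i_{\eta\otimes Y}\omega=\eta\wedge i_Y\omega$, and write $[\partial,i_\varphi]=\partial\circ i_\varphi-i_\varphi\circ\partial$. The extension map $e^{i_\varphi|i_{\bar\varphi}}$ is the linear map on forms with $$e^{i_\varphi|i_{\bar\varphi}}\big(f\,dz^I\wedge d\bar z^J\big)=f\,e^{i_\varphi}(dz^I)\wedge e^{i_{\bar\varphi}}(d\bar z^J),\qquad e^{\spadesuit}=\sum_{k\ge0}\tfrac1{k!}\spadesuit^k.$$ Finally, let $(\mathbf 1-\bar\varphi\varphi)\Finv$ (simultaneous contraction) be the linear map which, in $f\,dz^{i_1}\wedge\dots\wedge dz^{i_p}\wedge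 d\bar z^{j_1}\wedge\dots\wedge d\bar z^{j_q}$, keeps every $dz^i$ and replaces every $d\bar z^j$ by $d\bar z^j-\overline{\varphi^j_{\bar k}}\varphi^k_{\bar l}\,d\bar z^l$. Then for all $t$ sufficiently close to $0$ (independently of the forms below): the matrix $\partial\zeta/\partial z$ is invertible at every point of $X$, so that $\varphi(t)$ is defined; $e^{i_\varphi|i_{\bar\varphi}}$ maps $A^{p,q}(X_0)$ into $A^{p,q}(X_t)$ for all $p,q$, where $A^{p,q}$ denotes the smooth complex $(p,q)$-forms; and for every form $\alpha\in A^{p,q}(X_0)$, and more generally for every smooth complex $k$-form $\alpha$ on $X_0$ with any $k\ge 0$, $$\bar\partial_t\big(e^{i_\varphi|i_{\bar\varphi}}(\alpha)\big)=0\quad\Longleftrightarrow\quad\big([\partial,i_\varphi]+\bar\partial\big)\big((\mathbf 1-\bar\varphi\varphi)\Finv\alpha\big)=0 .$$ -/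

import Mathlib

open scoped Manifold ContDiff Topology
open TopologicalSpace

noncomputable section

namespace Deformation

/-- The model space `ℂⁿ`. -/
abbrev Cn (n : ℕ) : Type := Fin n → ℂ

/-- The complexified tangent space `T^{1,0} ⊕ T^{0,1}` in local coordinates `z`: the pair `(a, b)`
is the complex tangent vector `∑ aⁱ ∂/∂zⁱ + ∑ bⁱ ∂/∂z̄ⁱ`. -/
abbrev CTan (n : ℕ) : Type := Cn n × Cn n

/-- Complex-valued `k`-covectors: `ℂ`-multilinear alternating forms on the complexified tangent
space. -/
abbrev Covec (n k : ℕ) : Type := CTan n [⋀^Fin k]→L[ℂ] ℂ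

/-! ### Linear algebra on one complexified tangent space -/

/-- The vector `∂/∂zⁱ`. -/
def vecZ {n : ℕ} (i : Fin n) : CTan n := (Pi.single i 1, 0)

/-- The vector `∂/∂z̄ⁱ`. -/
def vecZbar {n : ℕ} (i : Fin n) : CTan n := (0, Pi.single i 1)

/-- The covector `dzⁱ`. -/
def dz {n : ℕ} (i : Fin n) : CTan n →L[ℂ] ℂ :=
  (ContinuousLinearMap.proj i).comp (ContinuousLinearMap.fst ℂ (Cn n) (Cn n))

/-- The covector `dz̄ⁱ`. -/
def dzbar {n : ℕ} (i : Fin n) : CTan n →L[ℂ] ℂ :=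
  (ContinuousLinearMap.proj i).comp (ContinuousLinearMap.snd ℂ (Cn n) (Cn n))

/-- The exterior product `θ ∧ β` of a `1`-covector `θ` with a `k`-covector `β`. -/
def wedgeOne {n k : ℕ} (θ : CTan n →L[ℂ] ℂ) (β : Covec n k) : Covec n (k + 1) :=
  ContinuousAlternatingMap.alternatizeUncurryFin (θ.smulRight β)

/-- A `k`-covector has type `(p,q)` if `p + q = k` and it vanishes on every `k`-tuple consisting of
vectors of `T^{1,0}` (at the places in `S`) and vectors of `T^{0,1}` (at the other places), unless
exactly `p` of the places belong to `T^{1,0}`. -/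
def IsType {n k : ℕ} (p q : ℕ) (β : Covec n k) : Prop :=
  p + q = k ∧ ∀ (S : Finset (Fin k)) (w : Fin k → CTan n),
    (∀ i ∈ S, (w i).2 = 0) → (∀ i ∉ S, (w i).1 = 0) → S.card ≠ p → β w = 0

/-- The contraction `i_N` with a vector-valued `1`-form `N` (an endomorphism of the complexified
tangent space). It is linear in `N`, and `i_{η ⊗ Y} β = η ∧ (i_Y β)`, see
`contract_smulRight`. -/
def contract {n : ℕ} (N : CTan n →L[ℂ] CTan n) : {k : ℕ} → Covec n k → Covec n k
  | 0, _ => 0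
  | _ + 1, β => ContinuousAlternatingMap.alternatizeUncurryFin (β.curryLeft.comp N)

theorem contract_smulRight {n k : ℕ} (η : CTan n →L[ℂ] ℂ) (Y : CTan n) (β : Covec n (k + 1)) :
    contract (η.smulRight Y) β = wedgeOne η (β.curryLeft Y) := by
  have h : β.curryLeft.comp (η.smulRight Y) = η.smulRight (β.curryLeft Y) := by
    exact ContinuousLinearMap.ext fun v => by simp
  simp only [contract, wedgeOne, h]

/-- The exponential `e^{i_N} = ∑ (1/m!) i_N^m` on `k`-covectors; it is used only for `N` with
`N ∘ N = 0`, where all the terms with `m > k` vanish. -/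
def expContract {n k : ℕ} (N : CTan n →L[ℂ] CTan n) (β : Covec n k) : Covec n k :=
  ∑ m ∈ Finset.range (k + 1), ((m.factorial : ℂ)⁻¹) • (contract N)^[m] β

/-- The simultaneous contraction `P ⨟ β`: every factor `θ` of a product `θ₁ ∧ ⋯ ∧ θ_k` of
`1`-covectors is replaced by `P ⌟ θ = θ ∘ P`, see `simul_wedgeList` and `wedge_simul`. -/
def simul {n k : ℕ} (P : CTan n →L[ℂ] CTan n) (β : Covec n k) : Covec n k :=
  β.compContinuousLinearMap P

/-- The tensor `φ = ∑ φⁱ_j dz̄ʲ ⊗ ∂/∂zⁱ` with coefficient matrix `M = (φⁱ_j)`. -/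
def tensor {n : ℕ} (M : Matrix (Fin n) (Fin n) ℂ) : CTan n →L[ℂ] CTan n :=
  ∑ i, ∑ j, (dzbar j).smulRight (M i j • vecZ i)

/-- The conjugate tensor `φ̄ = ∑ conj (φⁱ_j) dzʲ ⊗ ∂/∂z̄ⁱ`. -/
def tensorBar {n : ℕ} (M : Matrix (Fin n) (Fin n) ℂ) : CTan n →L[ℂ] CTan n :=
  ∑ i, ∑ j, (dz j).smulRight (star (M i j) • vecZbar i)

/-- The extension map `e^{i_φ | i_φ̄} = (1 + φ + φ̄) ⨟`. On a product `dz^I ∧ dz̄^J` it is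
`e^{i_φ}(dz^I) ∧ e^{i_φ̄}(dz̄^J)`, see `extend_decomposable` below. -/
def extend {n k : ℕ} (M : Matrix (Fin n) (Fin n) ℂ) (β : Covec n k) : Covec n k :=
  simul (1 + tensor M + tensorBar M) β

/-! The extension map on products of `1`-covectors. -/

theorem contract_apply {n k : ℕ} (N : CTan n →L[ℂ] CTan n) (β : Covec n k) (v : Fin k → CTan n) :
    contract N β v = ∑ i, β (Function.update v i (N (v i))) := by
  cases k with
  | zero => simp [contract]
  | succ k =>
    simp only [contract, ContinuousAlternatingMap.alternatizeUncurryFin_apply]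
    refine Finset.sum_congr rfl fun i _ => ?_
    have h := ContinuousAlternatingMap.map_insertNth β i (N (v i)) (i.removeNth v)
    rw [Fin.insertNth_removeNth] at h
    rw [h]
    rfl

theorem contract_add {n k : ℕ} (N : CTan n →L[ℂ] CTan n) (β γ : Covec n k) :
    contract N (β + γ) = contract N β + contract N γ := by
  ext v
  simp [contract_apply, Finset.sum_add_distrib]

theorem contract_smul {n k : ℕ} (N : CTan n →L[ℂ] CTan n) (c : ℂ) (β : Covec n k) :
    contract N (c • β) = c • contract N β := by
  ext v
  simp [contract_apply, Finset.mul_sum]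

/-- The exterior product `θ₁ ∧ ⋯ ∧ θ_k` of `1`-covectors. -/
def wedgeList {n : ℕ} : {k : ℕ} → (Fin k → (CTan n →L[ℂ] ℂ)) → Covec n k
  | 0, _ => ContinuousAlternatingMap.constOfIsEmpty ℂ (CTan n) (Fin 0) 1
  | _ + 1, θ => wedgeOne (θ 0) (wedgeList (Fin.tail θ))

/-- The exterior product of a `p`-covector and a `q`-covector. -/
def wedge {n p q : ℕ} (a : Covec n p) (b : Covec n q) : CTan n [⋀^Fin (p + q)]→ₗ[ℂ] ℂ :=
  ((LinearMap.mul' ℂ ℂ).compAlternatingMap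
    (a.toAlternatingMap.domCoprod b.toAlternatingMap)).domDomCongr finSumFinEquiv

theorem wedgeOne_apply {n k : ℕ} (θ : CTan n →L[ℂ] ℂ) (β : Covec n k) (v : Fin (k + 1) → CTan n) :
    wedgeOne θ β v = ∑ i : Fin (k + 1), (-1) ^ (i : ℕ) * (θ (v i) * β (i.removeNth v)) := by
  simp [wedgeOne, ContinuousAlternatingMap.alternatizeUncurryFin_apply]

theorem contract_wedgeOne {n k : ℕ} (N : CTan n →L[ℂ] CTan n) (θ : CTan n →L[ℂ] ℂ)
    (β : Covec n k) :
    contract N (wedgeOne θ β) = wedgeOne (θ.comp N) β + wedgeOne θ (contract N β) := by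
  ext v
  simp only [contract_apply, wedgeOne_apply, ContinuousAlternatingMap.add_apply,
    ContinuousLinearMap.comp_apply]
  rw [Finset.sum_comm, ← Finset.sum_add_distrib]
  refine Finset.sum_congr rfl fun i _ => ?_
  rw [Fin.sum_univ_succAbove _ i]
  simp only [Function.update_self, Fin.removeNth_update, Fin.removeNth_update_succAbove]
  congr 1
  simp only [Finset.mul_sum]
  refine Finset.sum_congr rfl fun j _ => ?_
  rw [Function.update_of_ne (Fin.succAbove_ne i j).symm]
  rfl

theorem wedgeOne_add_left {n k : ℕ} (θ θ' : CTan n →L[ℂ] ℂ) (β : Covec n k) :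
    wedgeOne (θ + θ') β = wedgeOne θ β + wedgeOne θ' β := by
  ext v
  simp [wedgeOne_apply, add_mul, mul_add, Finset.sum_add_distrib]

theorem wedgeOne_smul {n k : ℕ} (θ : CTan n →L[ℂ] ℂ) (c : ℂ) (β : Covec n k) :
    wedgeOne θ (c • β) = c • wedgeOne θ β := by
  ext v
  simp only [wedgeOne_apply, ContinuousAlternatingMap.smul_apply, smul_eq_mul, Finset.mul_sum]
  exact Finset.sum_congr rfl fun i _ => by ring

theorem wedgeOne_add {n k : ℕ} (θ : CTan n →L[ℂ] ℂ) (β γ : Covec n k) :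
    wedgeOne θ (β + γ) = wedgeOne θ β + wedgeOne θ γ := by
  ext v
  simp [wedgeOne_apply, mul_add, Finset.sum_add_distrib]

theorem wedgeOne_zero {n k : ℕ} (θ : CTan n →L[ℂ] ℂ) : wedgeOne θ (0 : Covec n k) = 0 := by
  ext v
  simp [wedgeOne_apply]

theorem covec_smul_zero {n k : ℕ} (c : ℂ) : c • (0 : Covec n k) = 0 := by
  ext v
  simp

theorem wedgeOne_sum {n k : ℕ} (θ : CTan n →L[ℂ] ℂ) (s : Finset ℕ) (f : ℕ → Covec n k) :
    wedgeOne θ (∑ m ∈ s, f m) = ∑ m ∈ s, wedgeOne θ (f m) := by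
  classical
  induction s using Finset.induction_on with
  | empty => simp [wedgeOne_zero]
  | insert a s ha ih => rw [Finset.sum_insert ha, Finset.sum_insert ha, wedgeOne_add, ih]

theorem iterate_contract_wedgeOne {n k : ℕ} (N : CTan n →L[ℂ] CTan n) (θ : CTan n →L[ℂ] ℂ)
    (h : (θ.comp N).comp N = 0) (β : Covec n k) (m : ℕ) :
    (contract N)^[m + 1] (wedgeOne θ β) = wedgeOne θ ((contract N)^[m + 1] β) +
      ((m : ℂ) + 1) • wedgeOne (θ.comp N) ((contract N)^[m] β) := by
  have h0 : ∀ γ : Covec n k, contract N (wedgeOne (θ.comp N) γ) =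
      wedgeOne (θ.comp N) (contract N γ) := by
    intro γ
    rw [contract_wedgeOne, h]
    have : wedgeOne (0 : CTan n →L[ℂ] ℂ) γ = 0 := by
      ext v
      simp [wedgeOne_apply]
    rw [this, zero_add]
  induction m with
  | zero => simp [contract_wedgeOne, add_comm]
  | succ m ih =>
    rw [Function.iterate_succ_apply', ih, contract_add, contract_smul, h0, contract_wedgeOne,
      ← Function.iterate_succ_apply' (contract N), ← Function.iterate_succ_apply' (contract N)]
    push_cast
    module

theorem iterate_contract_wedgeList {n k : ℕ} (N : CTan n →L[ℂ] CTan n)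
    (θ : Fin k → (CTan n →L[ℂ] ℂ)) (h : ∀ i, ((θ i).comp N).comp N = 0) :
    (contract N)^[k + 1] (wedgeList θ) = 0 := by
  induction k with
  | zero => rfl
  | succ k ih =>
    have hz : contract N (0 : Covec n k) = 0 := by
      ext v
      simp [contract_apply]
    have := ih (Fin.tail θ) fun i => h i.succ
    rw [wedgeList, iterate_contract_wedgeOne N _ (h 0), Function.iterate_succ_apply', this, hz,
      wedgeOne_zero, wedgeOne_zero, covec_smul_zero, add_zero]

/-- `e^{i_N}(θ₁ ∧ ⋯ ∧ θ_k) = (θ₁ + N ⌟ θ₁) ∧ ⋯ ∧ (θ_k + N ⌟ θ_k)`. -/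
theorem expContract_wedgeList {n k : ℕ} (N : CTan n →L[ℂ] CTan n)
    (θ : Fin k → (CTan n →L[ℂ] ℂ)) (h : ∀ i, ((θ i).comp N).comp N = 0) :
    expContract N (wedgeList θ) = wedgeList fun i => θ i + (θ i).comp N := by
  induction k with
  | zero => simp [expContract, wedgeList]
  | succ k ih =>
    have hi := ih (Fin.tail θ) fun i => h i.succ
    have hn := iterate_contract_wedgeList N (Fin.tail θ) fun i => h i.succ
    have hR : wedgeList (fun i => θ i + (θ i).comp N) =
        wedgeOne (θ 0 + (θ 0).comp N) (expContract N (wedgeList (Fin.tail θ))) := by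
      rw [hi]; rfl
    rw [hR, wedgeOne_add_left]
    simp only [expContract, wedgeOne_sum, wedgeOne_smul, wedgeList]
    have ht : ∀ m : ℕ, (((m + 1).factorial : ℂ)⁻¹) •
        (contract N)^[m + 1] (wedgeOne (θ 0) (wedgeList (Fin.tail θ))) =
        (((m + 1).factorial : ℂ)⁻¹) •
          wedgeOne (θ 0) ((contract N)^[m + 1] (wedgeList (Fin.tail θ))) +
        ((m.factorial : ℂ)⁻¹) •
          wedgeOne ((θ 0).comp N) ((contract N)^[m] (wedgeList (Fin.tail θ))) := by
      intro m
      rw [iterate_contract_wedgeOne N _ (h 0), smul_add, smul_smul]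
      congr 2
      have h1 : (m.factorial : ℂ) ≠ 0 := by exact_mod_cast m.factorial_ne_zero
      have h2 : (m : ℂ) + 1 ≠ 0 := by exact_mod_cast m.succ_ne_zero
      rw [Nat.factorial_succ]
      push_cast
      field_simp
    rw [Finset.sum_range_succ', Finset.sum_congr rfl fun m _ => ht m, Finset.sum_add_distrib,
      add_right_comm]
    congr 1
    have hs := Finset.sum_range_succ' (fun m : ℕ => ((m.factorial : ℂ)⁻¹) •
      wedgeOne (θ 0) ((contract N)^[m] (wedgeList (Fin.tail θ)))) (k + 1)
    rw [Finset.sum_range_succ, hn, wedgeOne_zero, covec_smul_zero, add_zero] at hs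
    simpa using hs.symm

theorem simul_wedgeList {n k : ℕ} (P : CTan n →L[ℂ] CTan n) (θ : Fin k → (CTan n →L[ℂ] ℂ)) :
    simul P (wedgeList θ) = wedgeList fun i => (θ i).comp P := by
  induction k with
  | zero => rfl
  | succ k ih =>
    have := ih (Fin.tail θ)
    ext v
    change wedgeOne (θ 0) (wedgeList (Fin.tail θ)) (P ∘ v) =
      wedgeOne ((θ 0).comp P) (wedgeList fun i : Fin k => (Fin.tail θ i).comp P) v
    rw [wedgeOne_apply, wedgeOne_apply]
    refine Finset.sum_congr rfl fun i _ => ?_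
    have h := DFunLike.congr_fun this (i.removeNth v)
    exact congrArg (fun c => (-1) ^ (i : ℕ) * ((θ 0) (P (v i)) * c)) h

theorem wedge_apply {n p q : ℕ} (a : Covec n p) (b : Covec n q) (v : Fin (p + q) → CTan n) :
    wedge a b v = ∑ σ : Equiv.Perm.ModSumCongr (Fin p) (Fin q), LinearMap.mul' ℂ ℂ
      (AlternatingMap.domCoprod.summand a.toAlternatingMap b.toAlternatingMap σ
        (v ∘ finSumFinEquiv)) := by
  simp [wedge, AlternatingMap.domCoprod_apply, Function.comp_def]

theorem wedge_simul {n p q : ℕ} (P : CTan n →L[ℂ] CTan n) (a : Covec n p) (b : Covec n q)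
    (v : Fin (p + q) → CTan n) : wedge (simul P a) (simul P b) v = wedge a b (P ∘ v) := by
  simp only [wedge_apply]
  refine Finset.sum_congr rfl fun σ _ => ?_
  induction σ using Quotient.inductionOn' with
  | h σ => rfl

theorem dz_comp_tensor {n : ℕ} (M : Matrix (Fin n) (Fin n) ℂ) (i : Fin n) :
    (dz i).comp (tensor M) = ∑ j, M i j • dzbar j := by
  ext v <;> simp [tensor, dz, dzbar, vecZ, Pi.single_apply, mul_comm]

theorem dzbar_comp_tensor {n : ℕ} (M : Matrix (Fin n) (Fin n) ℂ) (i : Fin n) :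
    (dzbar i).comp (tensor M) = 0 := by
  ext v <;> simp [tensor, dzbar, vecZ]

theorem dzbar_comp_tensorBar {n : ℕ} (M : Matrix (Fin n) (Fin n) ℂ) (i : Fin n) :
    (dzbar i).comp (tensorBar M) = ∑ j, star (M i j) • dz j := by
  ext v <;> simp [tensorBar, dz, dzbar, vecZbar, Pi.single_apply, mul_comm]

theorem dz_comp_tensorBar {n : ℕ} (M : Matrix (Fin n) (Fin n) ℂ) (i : Fin n) :
    (dz i).comp (tensorBar M) = 0 := by
  ext v <;> simp [tensorBar, dz, vecZbar]

/-- On `f dz^I ∧ dz̄^J` the extension map is `f e^{i_φ}(dz^I) ∧ e^{i_φ̄}(dz̄^J)`. -/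
theorem extend_decomposable {n p q : ℕ} (M : Matrix (Fin n) (Fin n) ℂ) (I : Fin p → Fin n)
    (J : Fin q → Fin n) (f : ℂ) (β : Covec n (p + q))
    (hβ : β.toAlternatingMap =
      f • wedge (wedgeList fun i => dz (I i)) (wedgeList fun j => dzbar (J j))) :
    (extend M β).toAlternatingMap =
      f • wedge (expContract (tensor M) (wedgeList fun i => dz (I i)))
        (expContract (tensorBar M) (wedgeList fun j => dzbar (J j))) := by
  have h1 : ∀ i : Fin p, ((dz (I i)).comp (tensor M)).comp (tensor M) = 0 := by
    intro i
    rw [dz_comp_tensor]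
    ext v <;> simp [tensor, dzbar, vecZ]
  have h2 : ∀ j : Fin q, ((dzbar (J j)).comp (tensorBar M)).comp (tensorBar M) = 0 := by
    intro j
    rw [dzbar_comp_tensorBar]
    ext v <;> simp [tensorBar, dz, vecZbar]
  rw [expContract_wedgeList _ _ h1, expContract_wedgeList _ _ h2]
  have h3 : (wedgeList fun i => dz (I i) + (dz (I i)).comp (tensor M)) =
      simul (1 + tensor M + tensorBar M) (wedgeList fun i => dz (I i)) := by
    rw [simul_wedgeList]
    congr 1
    funext i
    rw [ContinuousLinearMap.comp_add, ContinuousLinearMap.comp_add, dz_comp_tensorBar, add_zero]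
    rfl
  have h4 : (wedgeList fun j => dzbar (J j) + (dzbar (J j)).comp (tensorBar M)) =
      simul (1 + tensor M + tensorBar M) (wedgeList fun j => dzbar (J j)) := by
    rw [simul_wedgeList]
    congr 1
    funext j
    rw [ContinuousLinearMap.comp_add, ContinuousLinearMap.comp_add, dzbar_comp_tensor, add_zero]
    rfl
  rw [h3, h4]
  ext v
  have h := DFunLike.congr_fun hβ ((1 + tensor M + tensorBar M : CTan n →L[ℂ] CTan n) ∘ v)
  rw [AlternatingMap.smul_apply, ← wedge_simul] at h
  exact h

/-! ### Differential forms in an open set of `ℂⁿ` -/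

section Wirtinger

variable {V : Type*} [NormedAddCommGroup V] [NormedSpace ℂ V]

/-- `∂/∂zʲ = (∂/∂xʲ - i ∂/∂yʲ) / 2`, applied to a map with real differential `L`. -/
def wirt {n : ℕ} (L : Cn n →L[ℝ] V) (j : Fin n) : V :=
  (1 / 2 : ℂ) • (L (Pi.single j 1) - Complex.I • L (Pi.single j Complex.I))

/-- `∂/∂z̄ʲ = (∂/∂xʲ + i ∂/∂yʲ) / 2`, applied to a map with real differential `L`. -/
def wirtBar {n : ℕ} (L : Cn n →L[ℝ] V) (j : Fin n) : V :=
  (1 / 2 : ℂ) • (L (Pi.single j 1) + Complex.I • L (Pi.single j Complex.I))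

/-- The complex linear extension `∑ dzʲ ⊗ ∂/∂zʲ + ∑ dz̄ʲ ⊗ ∂/∂z̄ʲ` of a real differential to the
complexified tangent space. -/
def complexExt {n : ℕ} (L : Cn n →L[ℝ] V) : CTan n →L[ℂ] V :=
  ∑ j, ((dz j).smulRight (wirt L j) + (dzbar j).smulRight (wirtBar L j))

end Wirtinger

/-- The complexification of the real differential `L` of a map `f` into `ℂⁿ`, with the rows
`∂f/∂z, ∂f/∂z̄` and `∂f̄/∂z, ∂f̄/∂z̄`. -/
def complexify {n : ℕ} (L : Cn n →L[ℝ] Cn n) : CTan n →L[ℂ] CTan n :=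
  (complexExt L).prod (complexExt ((starL' ℝ : Cn n ≃L[ℝ] Cn n).toContinuousLinearMap.comp L))

/-- `∂β = ∑ dzʲ ∧ ∂β/∂zʲ`. -/
def delFlat {n k : ℕ} (β : Cn n → Covec n k) (z : Cn n) : Covec n (k + 1) :=
  ∑ j, wedgeOne (dz j) (wirt (fderiv ℝ β z) j)

/-- `∂̄β = ∑ dz̄ʲ ∧ ∂β/∂z̄ʲ`. -/
def delbarFlat {n k : ℕ} (β : Cn n → Covec n k) (z : Cn n) : Covec n (k + 1) :=
  ∑ j, wedgeOne (dzbar j) (wirtBar (fderiv ℝ β z) j)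

/-! ### Differential forms on a manifold -/

section Forms

variable {n : ℕ} {X : Type*} [TopologicalSpace X] [ChartedSpace (Cn n) X]

/-- The real differential at `x` of a local coordinate system `e`, the tangent space of `X` at `x`
being `ℂⁿ` through the preferred chart at `x`. -/
def dCoord (e : OpenPartialHomeomorph X (Cn n)) (x : X) : Cn n →L[ℝ] Cn n :=
  mfderiv 𝓘(ℝ, Cn n) 𝓘(ℝ, Cn n) e x

/-- The real differential of the inverse of a local coordinate system `e`. -/
def dCoordSymm (e : OpenPartialHomeomorph X (Cn n)) (z : Cn n) : Cn n →L[ℝ] Cn n :=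
  mfderiv 𝓘(ℝ, Cn n) 𝓘(ℝ, Cn n) e.symm z

variable (n X) in
/-- Complex-valued `k`-forms (no regularity) on `X`. The value at `x` is a covector on the
complexification of the tangent space at `x`, written in the frame `∂/∂zⁱ`, `∂/∂z̄ⁱ` of the
preferred chart at `x`. -/
abbrev KForm (k : ℕ) : Type _ := X → Covec n k

/-- The expression `(e⁻¹)^* α` of a form in local coordinates `e`. -/
def localRep {k : ℕ} (e : OpenPartialHomeomorph X (Cn n)) (α : KForm n X k) (z : Cn n) :
    Covec n k :=
  (α (e.symm z)).compContinuousLinearMap (complexify (dCoordSymm e z))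

/-- Smooth forms: all expressions in the charts of `X` are smooth. -/
def IsSmooth {k : ℕ} (α : KForm n X k) : Prop :=
  ∀ e ∈ atlas (Cn n) X, ContDiffOn ℝ ∞ (localRep e α) e.target

variable (n X) in
/-- A choice of a local coordinate system around each point. A complex structure on `X` enters
the following definitions through such a choice of holomorphic coordinates. -/
abbrev Coords : Type _ := X → OpenPartialHomeomorph X (Cn n)

variable (n X) in
/-- The holomorphic coordinates of the complex manifold `X` itself. -/
def ownCoords : Coords n X := fun x => chartAt (Cn n) x

/-- The operator `∂` of the complex structure with the holomorphic coordinates `c`. -/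
def del {k : ℕ} (c : Coords n X) (α : KForm n X k) : KForm n X (k + 1) := fun x =>
  (delFlat (localRep (c x) α) (c x x)).compContinuousLinearMap (complexify (dCoord (c x) x))

/-- The operator `∂̄` of the complex structure with the holomorphic coordinates `c`. -/
def delbar {k : ℕ} (c : Coords n X) (α : KForm n X k) : KForm n X (k + 1) := fun x =>
  (delbarFlat (localRep (c x) α) (c x x)).compContinuousLinearMap (complexify (dCoord (c x) x))

/-- `α ∈ A^{p,q}`: smooth forms of type `(p,q)` with respect to the complex structure with the
holomorphic coordinates `c`. -/
def IsPQForm {k : ℕ} (c : Coords n X) (p q : ℕ) (α : KForm n X k) : Prop :=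
  IsSmooth α ∧ ∀ x, IsType p q (localRep (c x) α (c x x))

/-- The contraction `i_φ α`. Here `φ x` is the coefficient matrix of `φ` at `x` in the frame of the
preferred chart at `x`. -/
def contractForm {k : ℕ} (φ : X → Matrix (Fin n) (Fin n) ℂ) (α : KForm n X k) : KForm n X k :=
  fun x => contract (tensor (φ x)) (α x)

/-- The extension map `e^{i_φ | i_φ̄}` on forms. -/
def extendForm {k : ℕ} (φ : X → Matrix (Fin n) (Fin n) ℂ) (α : KForm n X k) : KForm n X k :=
  fun x => extend (φ x) (α x)

/-- The form `(1 - φ̄φ) ⨟ α`. -/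
def simulForm {k : ℕ} (φ : X → Matrix (Fin n) (Fin n) ℂ) (α : KForm n X k) : KForm n X k :=
  fun x => simul (1 - (tensorBar (φ x)).comp (tensor (φ x))) (α x)

end Forms

/-! ### Differentiable families of compact complex manifolds -/

/-- A differentiable family `π : 𝒳 → B` of `n`-dimensional compact complex manifolds over a domain
`B` of `ℝᵐ` with `0 ∈ B`. The fibre `X_t = π⁻¹(t)` carries the complex structure with the local
holomorphic coordinates `ζ_j`, where `chart j = (ζ_j, π)`. -/
structure DifferentiableFamily (n : ℕ) {m : ℕ} (B : Opens (EuclideanSpace ℝ (Fin m)))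
    (ι 𝒳 : Type*) [TopologicalSpace 𝒳] [ChartedSpace (Cn n × EuclideanSpace ℝ (Fin m)) 𝒳] where
  zero_mem : (0 : EuclideanSpace ℝ (Fin m)) ∈ B
  connected_base : IsConnected (B : Set (EuclideanSpace ℝ (Fin m)))
  π : 𝒳 → B
  contMDiff_π : ContMDiff 𝓘(ℝ, Cn n × EuclideanSpace ℝ (Fin m)) 𝓘(ℝ, EuclideanSpace ℝ (Fin m)) ∞ π
  surjective_π : Function.Surjective π
  submersion : ∀ p : 𝒳, Function.Surjective
    (mfderiv 𝓘(ℝ, Cn n × EuclideanSpace ℝ (Fin m)) 𝓘(ℝ, EuclideanSpace ℝ (Fin m)) π p)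
  isCompact_fiber : ∀ t : B, IsCompact (π ⁻¹' {t})
  isConnected_fiber : ∀ t : B, IsConnected (π ⁻¹' {t})
  chart : ι → OpenPartialHomeomorph 𝒳 (Cn n × EuclideanSpace ℝ (Fin m))
  locallyFinite : LocallyFinite fun j => (chart j).source
  covers : ∀ p : 𝒳, ∃ j, p ∈ (chart j).source
  smooth_chart : ∀ j, chart j ∈
    IsManifold.maximalAtlas 𝓘(ℝ, Cn n × EuclideanSpace ℝ (Fin m)) ∞ 𝒳
  chart_snd : ∀ j, ∀ p ∈ (chart j).source, (chart j p).2 = π p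
  holomorphic_transition : ∀ (j k : ι) (t : B),
    DifferentiableOn ℂ (fun z : Cn n => (chart j ((chart k).symm (z, t))).1)
      {z : Cn n | (z, (t : EuclideanSpace ℝ (Fin m))) ∈ (chart k).target ∧
        (chart k).symm (z, t) ∈ (chart j).source}

namespace DifferentiableFamily

variable {n m : ℕ} {B : Opens (EuclideanSpace ℝ (Fin m))} {ι 𝒳 : Type*} [TopologicalSpace 𝒳]
  [ChartedSpace (Cn n × EuclideanSpace ℝ (Fin m)) 𝒳]

/-- The base point `0 ∈ B`. -/
def base (F : DifferentiableFamily n B ι 𝒳) : B := ⟨0, F.zero_mem⟩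

/-- A differentiable trivialization `Φ : X × B ≅ 𝒳` over `B` of the family, whose restriction to
`X × {0}` identifies the complex manifold `X` with the central fibre `X_0 = π⁻¹(0)`. -/
structure Trivialization (F : DifferentiableFamily n B ι 𝒳)
    (X : Type*) [TopologicalSpace X] [ChartedSpace (Cn n) X] where
  toDiffeo : (X × B) ≃ₘ⟮𝓘(ℝ, Cn n).prod 𝓘(ℝ, EuclideanSpace ℝ (Fin m)),
    𝓘(ℝ, Cn n × EuclideanSpace ℝ (Fin m))⟯ 𝒳
  proj : ∀ (x : X) (t : B), F.π (toDiffeo (x, t)) = t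
  holomorphic_base : ∀ j, MDifferentiableOn 𝓘(ℂ, Cn n) 𝓘(ℂ, Cn n)
    (fun x : X => (F.chart j (toDiffeo (x, F.base))).1)
    {x : X | toDiffeo (x, F.base) ∈ (F.chart j).source}

namespace Trivialization

variable {F : DifferentiableFamily n B ι 𝒳} {X : Type*} [TopologicalSpace X]
  [ChartedSpace (Cn n) X] (Φ : F.Trivialization X)

theorem chart_mk (j : ι) (x : X) (t : B) (h : Φ.toDiffeo (x, t) ∈ (F.chart j).source) :
    F.chart j (Φ.toDiffeo (x, t)) = ((F.chart j (Φ.toDiffeo (x, t))).1, (t : EuclideanSpace ℝ _)) :=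
  Prod.ext rfl (by rw [F.chart_snd j _ h, Φ.proj])

theorem symm_mk (j : ι) (z : Cn n) (t : B)
    (h : (z, (t : EuclideanSpace ℝ (Fin m))) ∈ (F.chart j).target) :
    Φ.toDiffeo ((Φ.toDiffeo.symm ((F.chart j).symm (z, t))).1, t) = (F.chart j).symm (z, t) := by
  set p := (F.chart j).symm (z, (t : EuclideanSpace ℝ (Fin m))) with hp
  have h1 : F.π p = t := by
    apply Subtype.ext
    rw [← F.chart_snd j p ((F.chart j).map_target h), hp, (F.chart j).right_inv h]
  have h2 : F.π (Φ.toDiffeo (Φ.toDiffeo.symm p)) = (Φ.toDiffeo.symm p).2 :=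
    Φ.proj (Φ.toDiffeo.symm p).1 (Φ.toDiffeo.symm p).2
  rw [Φ.toDiffeo.apply_symm_apply, h1] at h2
  rw [h2, Prod.mk.eta, Φ.toDiffeo.apply_symm_apply]

/-- The local holomorphic coordinates `x ↦ ζ_j(x, t)` of `X_t`, as functions on `X`. -/
def coord (t : B) (j : ι) : OpenPartialHomeomorph X (Cn n) where
  toFun x := (F.chart j (Φ.toDiffeo (x, t))).1
  invFun z := (Φ.toDiffeo.symm ((F.chart j).symm (z, t))).1
  source := {x | Φ.toDiffeo (x, t) ∈ (F.chart j).source}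
  target := {z | (z, (t : EuclideanSpace ℝ (Fin m))) ∈ (F.chart j).target}
  map_source' x hx := by
    have h := (F.chart j).map_source hx
    rwa [Φ.chart_mk j x t hx] at h
  map_target' z hz := by
    change Φ.toDiffeo (_, t) ∈ (F.chart j).source
    rw [Φ.symm_mk j z t hz]
    exact (F.chart j).map_target hz
  left_inv' x hx := by
    rw [← Φ.chart_mk j x t hx, (F.chart j).left_inv hx, Φ.toDiffeo.symm_apply_apply]
  right_inv' z hz := by
    rw [Φ.symm_mk j z t hz, (F.chart j).right_inv hz]
  open_source := (F.chart j).open_source.preimage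
    (Φ.toDiffeo.continuous.comp (Continuous.prodMk_left t))
  open_target := (F.chart j).open_target.preimage (Continuous.prodMk_left _)
  continuousOn_toFun := continuous_fst.comp_continuousOn
    ((F.chart j).continuousOn.comp
      (Φ.toDiffeo.continuous.comp (Continuous.prodMk_left t)).continuousOn fun _ hx => hx)
  continuousOn_invFun := continuous_fst.comp_continuousOn
    (Φ.toDiffeo.symm.continuous.comp_continuousOn
      ((F.chart j).symm.continuousOn.comp (Continuous.prodMk_left _).continuousOn fun _ hz => hz))

/-- The index of a coordinate system `ζ_j` around the point of `X_t` corresponding to `x`. -/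
def index (t : B) (x : X) : ι := (F.covers (Φ.toDiffeo (x, t))).choose

theorem mem_source_index (t : B) (x : X) : x ∈ (Φ.coord t (Φ.index t x)).source :=
  (F.covers (Φ.toDiffeo (x, t))).choose_spec

/-- The holomorphic coordinates of `X_t`. -/
def coordsAt (t : B) : Coords n X := fun x => Φ.coord t (Φ.index t x)

/-- The matrix `∂ζ/∂z`, with `z` the preferred chart of `X` at `x`. -/
def dzeta_dz (t : B) (x : X) : Matrix (Fin n) (Fin n) ℂ :=
  Matrix.of fun i j => wirt (dCoord (Φ.coordsAt t x) x) j i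

/-- The matrix `∂ζ/∂z̄`. -/
def dzeta_dzbar (t : B) (x : X) : Matrix (Fin n) (Fin n) ℂ :=
  Matrix.of fun i j => wirtBar (dCoord (Φ.coordsAt t x) x) j i

/-- The Beltrami differential `φ(t) = (∂ζ/∂z)⁻¹ (∂ζ/∂z̄)`, as a coefficient matrix `(φⁱ_j)` at each
point; it is meaningful if `∂ζ/∂z` is invertible. -/
def beltrami (t : B) (x : X) : Matrix (Fin n) (Fin n) ℂ :=
  (Φ.dzeta_dz t x)⁻¹ * Φ.dzeta_dzbar t x

end Trivialization

end DifferentiableFamily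

end Deformation

end

noncomputable section

namespace Deformation

/-! ### Complexified differentials -/

section ComplexifiedDifferential

variable {n : ℕ} {V : Type*} [NormedAddCommGroup V] [NormedSpace ℂ V]

/-! Both equations are pullbacks of one expression by invertible bundle maps.

Locally, let `f` be the expression of coordinates `ζ` of `X_t` in a chart `z` of `X_0`, and let `D`
be its complexified differential. Write `P`, `P̄` for the projections to `T^{1,0}`, `T^{0,1}`. Since
`ζ_z φ = ζ_z̄`, `D = Δ ∘ (1 + φ + φ̄)` with `Δ = diag(ζ_z, conj ζ_z)`
(`complexify_eq_diagPart_comp`). If `γ` is the expression of `e^{i_φ|i_φ̄} α` in the coordinates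
`ζ`, then `D^*(γ ∘ f) = (1 + φ + φ̄)^* α`, hence `α = Δ^*(γ ∘ f)`. As `Δ` is block diagonal, types
are preserved.

Put `E = P̄ - φ`. Then `P D E = 0`, and `A = D E + P D P` equals `Δ ∘ (1 - φ̄φ)`
(`complexify_comp_sub_add`). Thus `β = (1 - φ̄φ) ⨟ α` is `A^*(γ ∘ f)`. The heart of the proof is the
identity `[∂, i_φ] β + ∂̄ β = A^*(∂̄ γ)` (`delFlat_contract_sub_add_delbarFlat`), which needs no
decomposition into types. Expanding by the Leibniz rule, the left side is the alternatization of
`∇_E β` plus that of the contraction of `β` with `∇_P φ`. The derivatives of `γ` give `A^*(∂̄ γ)`,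
because `P̄ A = D E`; the derivatives of `D` and `φ` combine into a bilinear map `K` applied to `γ`,
and `K` is symmetric, so its alternatization vanishes. The symmetry rests on that of the second
derivative of `f` and on the integrability of `φ`, itself obtained by differentiating `P D E = 0`.
Since `A` is surjective, `A^*` is injective and the equivalence follows (`delbarFlat_eq_zero_iff`).

To globalize, the Beltrami matrix does not change under holomorphic changes of `ζ` and transforms as
a tensor under holomorphic changes of `z`. Finally, `ζ_z` is invertible at `t = 0`, where `ζ` is
holomorphic on `X`; by continuity in `(t, x)` and compactness of `X` it remains so everywhere for
small `t`. -/

theorem complexExt_apply (L : Cn n →L[ℝ] V) (w : CTan n) :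
    complexExt L w = ∑ j, (w.1 j • wirt L j + w.2 j • wirtBar L j) := by
  simp [complexExt, dz, dzbar]

/-- A real differential is the restriction of its complex linear extension to real vectors. -/
theorem complexExt_real (L : Cn n →L[ℝ] V) (v : Cn n) : complexExt L (v, star v) = L v := by
  have hv : v = ∑ j, ((v j).re • (Pi.single j 1 : Cn n) + (v j).im • (Pi.single j Complex.I : Cn n)) := by
    ext i
    simp [Finset.sum_apply, Pi.single_apply, Finset.sum_add_distrib]
  conv_rhs => rw [hv]
  rw [complexExt_apply, map_sum]
  refine Finset.sum_congr rfl fun j _ => ?_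
  simp only [map_add, map_smul, wirt, wirtBar, Pi.star_apply]
  generalize L (Pi.single j 1) = p
  generalize L (Pi.single j Complex.I) = q
  have h1 : (v j).re • p = ((v j).re : ℂ) • p := (Complex.coe_smul _ _).symm
  have h2 : (v j).im • q = ((v j).im : ℂ) • q := (Complex.coe_smul _ _).symm
  rw [h1, h2]
  have h3 : v j = (v j).re + (v j).im * Complex.I := (Complex.re_add_im _).symm
  have h4 : star (v j) = (v j).re - (v j).im * Complex.I := by
    apply Complex.ext <;> simp
  rw [h4]
  conv_lhs => enter [1, 1]; rw [h3]
  generalize ((v j).re : ℂ) = r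
  generalize ((v j).im : ℂ) = s
  simp only [smul_sub, smul_add, smul_smul]
  have e1 : (r + s * Complex.I) * (1 / 2 * Complex.I) = r * Complex.I / 2 - s / 2 := by
    linear_combination (s / 2) * Complex.I_mul_I
  have e2 : (r - s * Complex.I) * (1 / 2 * Complex.I) = r * Complex.I / 2 + s / 2 := by
    linear_combination (-s / 2) * Complex.I_mul_I
  rw [e1, e2]
  module

/-- The real vectors span the complexified tangent space. -/
theorem exists_real_add_I_smul_real (w : CTan n) :
    ∃ u v : Cn n, w = (u, star u) + Complex.I • (v, star v) := by
  -- The real and imaginary parts of `w` for the conjugation `(a, b) ↦ (star b, star a)`, whose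
  -- fixed vectors are the `(v, star v)`.
  refine ⟨fun j => (w.1 j + star (w.2 j)) / 2, fun j => -Complex.I * (w.1 j - star (w.2 j)) / 2, ?_⟩
  ext j
  · simp only [Prod.fst_add, Prod.smul_fst, Pi.add_apply, Pi.smul_apply, smul_eq_mul]
    linear_combination (-(w.1 j - star (w.2 j)) / 2) * (-Complex.I_mul_I)
  · simp only [Prod.snd_add, Prod.smul_snd, Pi.add_apply, Pi.smul_apply, smul_eq_mul, Pi.star_apply]
    simp only [Complex.star_def, map_div₀, map_add, map_mul, map_neg, map_sub, Complex.conj_I,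
      Complex.conj_conj, Complex.conj_ofNat]
    linear_combination (-((starRingEnd ℂ) (w.1 j) - w.2 j) / 2) * Complex.I_mul_I

/-- Real vectors span over `ℂ`. This reduces the chain and Leibniz rules for complexified
differentials to those for `fderiv ℝ`, without computing with Wirtinger derivatives. -/
theorem clm_ext_real {T T' : CTan n →L[ℂ] V} (h : ∀ v, T (v, star v) = T' (v, star v)) :
    T = T' := by
  refine ContinuousLinearMap.ext fun w => ?_
  obtain ⟨u, v, rfl⟩ := exists_real_add_I_smul_real w
  simp only [map_add, map_smul, h]

theorem complexify_real (L : Cn n →L[ℝ] Cn n) (v : Cn n) :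
    complexify L (v, star v) = (L v, star (L v)) := by
  simp [complexify, complexExt_real]

theorem complexify_comp (L L' : Cn n →L[ℝ] Cn n) :
    complexify (L.comp L') = (complexify L).comp (complexify L') :=
  clm_ext_real fun v => by simp [complexify_real]

theorem complexify_id : complexify (ContinuousLinearMap.id ℝ (Cn n)) = 1 :=
  clm_ext_real fun v => by simp [complexify_real]

theorem complexExt_comp (L : Cn n →L[ℝ] V) (L' : Cn n →L[ℝ] Cn n) :
    complexExt (L.comp L') = (complexExt L).comp (complexify L') :=
  clm_ext_real fun v => by simp [complexify_real, complexExt_real]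

/-- `complexify` as a continuous real linear map. -/
def complexifyL (n : ℕ) : (Cn n →L[ℝ] Cn n) →L[ℝ] (CTan n →L[ℂ] CTan n) :=
  LinearMap.toContinuousLinearMap
    { toFun := complexify
      map_add' := fun L L' => clm_ext_real fun v => by simp [complexify_real]
      map_smul' := fun c L => clm_ext_real fun v => by
        simp only [complexify_real, RingHom.id_apply]
        ext j <;> simp [complexify_real] }

theorem complexifyL_apply (L : Cn n →L[ℝ] Cn n) : complexifyL n L = complexify L := rfl

/-- The matrix `∂f/∂z` of a real differential. -/
def wirtMat (L : Cn n →L[ℝ] Cn n) : Matrix (Fin n) (Fin n) ℂ := Matrix.of fun i j => wirt L j i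

/-- The matrix `∂f/∂z̄` of a real differential. -/
def wirtBarMat (L : Cn n →L[ℝ] Cn n) : Matrix (Fin n) (Fin n) ℂ :=
  Matrix.of fun i j => wirtBar L j i

theorem complexify_apply (L : Cn n →L[ℝ] Cn n) (w : CTan n) :
    complexify L w = ((wirtMat L).mulVec w.1 + (wirtBarMat L).mulVec w.2,
      ((wirtBarMat L).map star).mulVec w.1 + ((wirtMat L).map star).mulVec w.2) := by
  have h1 : ∀ w : CTan n, complexExt L w = (wirtMat L).mulVec w.1 + (wirtBarMat L).mulVec w.2 := by
    intro w
    rw [complexExt_apply]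
    ext i
    simp [Matrix.mulVec, dotProduct, wirtMat, wirtBarMat, Finset.sum_add_distrib, mul_comm]
  refine Prod.ext (h1 w) ?_
  change complexExt _ w = _
  rw [complexExt_apply]
  ext i
  simp only [wirt, wirtBar, Matrix.mulVec, dotProduct, wirtMat, wirtBarMat,
    Finset.sum_apply, Pi.add_apply, Pi.smul_apply, smul_eq_mul, Matrix.map_apply, Matrix.of_apply,
    ← Finset.sum_add_distrib]
  refine Finset.sum_congr rfl fun j _ => ?_
  simp
  ring

theorem tensor_apply (M : Matrix (Fin n) (Fin n) ℂ) (w : CTan n) :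
    tensor M w = (M.mulVec w.2, 0) := by
  ext i
  · have h := DFunLike.congr_fun (dz_comp_tensor M i) w
    simpa [dz, dzbar, Matrix.mulVec, dotProduct] using h
  · have h := DFunLike.congr_fun (dzbar_comp_tensor M i) w
    simpa [dzbar] using h

theorem tensorBar_apply (M : Matrix (Fin n) (Fin n) ℂ) (w : CTan n) :
    tensorBar M w = (0, (M.map star).mulVec w.1) := by
  ext i
  · have h := DFunLike.congr_fun (dz_comp_tensorBar M i) w
    simpa [dz] using h
  · have h := DFunLike.congr_fun (dzbar_comp_tensorBar M i) w
    simpa [dz, dzbar, Matrix.mulVec, dotProduct] using h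

/-- The complexified differential `∑ dzʲ ⊗ ∂g/∂zʲ + ∑ dz̄ʲ ⊗ ∂g/∂z̄ʲ` of a map. -/
def cderiv (g : Cn n → V) (z : Cn n) : CTan n →L[ℂ] V := complexExt (fderiv ℝ g z)

theorem cderiv_real (g : Cn n → V) (z v : Cn n) :
    cderiv g z (v, star v) = fderiv ℝ g z v := complexExt_real _ v

theorem cderiv_congr {g h : Cn n → V} {z : Cn n} (e : g =ᶠ[𝓝 z] h) : cderiv g z = cderiv h z := by
  rw [cderiv, e.fderiv_eq, cderiv]

theorem cderiv_comp {g : Cn n → V} {f : Cn n → Cn n} {z : Cn n}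
    (hg : DifferentiableAt ℝ g (f z)) (hf : DifferentiableAt ℝ f z) :
    cderiv (fun y => g (f y)) z = (cderiv g (f z)).comp (complexify (fderiv ℝ f z)) := by
  rw [cderiv, fderiv_fun_comp z hg hf, complexExt_comp, cderiv]

/-- The Leibniz rule. -/
theorem cderiv_bilinear {V₁ V₂ : Type*} [NormedAddCommGroup V₁] [NormedSpace ℂ V₁]
    [NormedAddCommGroup V₂] [NormedSpace ℂ V₂] (b : V₁ →L[ℂ] V₂ →L[ℂ] V) {g : Cn n → V₁}
    {h : Cn n → V₂} {z : Cn n} (hg : DifferentiableAt ℝ g z) (hh : DifferentiableAt ℝ h z)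
    (w : CTan n) :
    cderiv (fun y => b (g y) (h y)) z w =
      b (cderiv g z w) (h z) + b (g z) (cderiv h z w) := by
  have key : cderiv (fun y => b (g y) (h y)) z =
      (b.flip (h z)).comp (cderiv g z) + (b (g z)).comp (cderiv h z) := by
    refine clm_ext_real fun v => ?_
    have := ((b.bilinearRestrictScalars ℝ).hasFDerivAt_of_bilinear hg.hasFDerivAt
      hh.hasFDerivAt).fderiv
    rw [cderiv_real]
    have h2 := DFunLike.congr_fun this v
    simp only [ContinuousLinearMap.bilinearRestrictScalars_apply_apply] at h2
    rw [h2]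
    simp [cderiv_real, add_comm]
  rw [key]
  simp

theorem cderiv_sub {g h : Cn n → V} {z : Cn n} (hg : DifferentiableAt ℝ g z)
    (hh : DifferentiableAt ℝ h z) :
    cderiv (fun y => g y - h y) z = cderiv g z - cderiv h z := by
  refine clm_ext_real fun v => ?_
  simp [cderiv_real, fderiv_fun_sub hg hh]

theorem cderiv_add {g h : Cn n → V} {z : Cn n} (hg : DifferentiableAt ℝ g z)
    (hh : DifferentiableAt ℝ h z) :
    cderiv (fun y => g y + h y) z = cderiv g z + cderiv h z := by
  refine clm_ext_real fun v => ?_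
  simp [cderiv_real, fderiv_fun_add hg hh]

theorem cderiv_const (c : V) (z : Cn n) : cderiv (fun _ => c) z = 0 :=
  clm_ext_real fun v => by simp [cderiv_real]

/-- The complexified second derivative is symmetric. -/
theorem cderiv_complexify_fderiv_symm {f : Cn n → Cn n} {z : Cn n} (hf : ContDiffAt ℝ ∞ f z)
    (v w : CTan n) :
    cderiv (fun y => complexify (fderiv ℝ f y)) z v w =
      cderiv (fun y => complexify (fderiv ℝ f y)) z w v := by
  have hd : DifferentiableAt ℝ (fderiv ℝ f) z :=
    (hf.fderiv_right (m := 1) (by norm_cast)).differentiableAt (by norm_num)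
  set H := cderiv (fun y => complexify (fderiv ℝ f y)) z with hH
  have hsymm : IsSymmSndFDerivAt ℝ f z := hf.isSymmSndFDerivAt (by simp; exact WithTop.coe_le_coe.2 (le_top (a := (2 : ℕ∞))))
  -- On real vectors `H` is the real second derivative of `f` paired with its conjugate; the general
  -- case follows by complex bilinearity.
  have hr : ∀ u u' : Cn n, H (u, star u) (u', star u') = H (u', star u') (u, star u) := by
    have : ∀ u u' : Cn n, H (u, star u) (u', star u') =
        (fderiv ℝ (fderiv ℝ f) z u u', star (fderiv ℝ (fderiv ℝ f) z u u')) := by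
      intro u u'
      rw [hH, cderiv_real]
      have := ((complexifyL n).hasFDerivAt.comp z hd.hasFDerivAt).fderiv
      have h2 := DFunLike.congr_fun this u
      simp only [Function.comp_def, complexifyL_apply] at h2
      rw [h2]
      simp [complexifyL_apply, complexify_real]
    intro u u'
    rw [this, this, hsymm.eq]
  obtain ⟨a, b, rfl⟩ := exists_real_add_I_smul_real v
  obtain ⟨c, d, rfl⟩ := exists_real_add_I_smul_real w
  simp only [map_add, map_smul, add_apply, smul_apply,
    hr c a, hr c b, hr d a, hr d b]
  simp only [smul_add]
  abel

end ComplexifiedDifferential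

/-! ### The operators `∂`, `∂̄` and contractions in an open set of `ℂⁿ` -/

section Flat

open ContinuousAlternatingMap (alternatizeUncurryFin alternatizeUncurryFinCLM
  alternatizeUncurryFinCLM_apply alternatizeUncurryFin_apply fderivCompContinuousLinearMapCLM
  fderivCompContinuousLinearMapCLM_apply fderivCompContinuousLinearMap_apply
  compContinuousLinearMap_apply compContinuousLinearMapCLM
  hasStrictFDerivAt_compContinuousLinearMap
  alternatizeUncurryFin_fderivCompContinuousLinearMap_eq_zero)

variable {n k : ℕ}

/-- The projection of the complexified tangent space onto `T^{1,0}`. -/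
def projZ (n : ℕ) : CTan n →L[ℂ] CTan n :=
  (ContinuousLinearMap.inl ℂ (Cn n) (Cn n)).comp (ContinuousLinearMap.fst ℂ (Cn n) (Cn n))

/-- The projection of the complexified tangent space onto `T^{0,1}`. -/
def projZbar (n : ℕ) : CTan n →L[ℂ] CTan n :=
  (ContinuousLinearMap.inr ℂ (Cn n) (Cn n)).comp (ContinuousLinearMap.snd ℂ (Cn n) (Cn n))

@[simp] theorem projZ_apply (w : CTan n) : projZ n w = (w.1, 0) := rfl

@[simp] theorem projZbar_apply (w : CTan n) : projZbar n w = (0, w.2) := rfl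

theorem delFlat_eq (β : Cn n → Covec n k) (z : Cn n) :
    delFlat β z = alternatizeUncurryFin ((cderiv β z).comp (projZ n)) := by
  have h : (cderiv β z).comp (projZ n) = ∑ j, (dz j).smulRight (wirt (fderiv ℝ β z) j) := by
    ext1 <;> refine ContinuousLinearMap.ext fun w => ?_ <;>
      simp [cderiv, complexExt_apply, dz]
  simp only [delFlat, wedgeOne, h, ← alternatizeUncurryFinCLM_apply, map_sum]

theorem delbarFlat_eq (β : Cn n → Covec n k) (z : Cn n) :
    delbarFlat β z = alternatizeUncurryFin ((cderiv β z).comp (projZbar n)) := by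
  have h : (cderiv β z).comp (projZbar n) =
      ∑ j, (dzbar j).smulRight (wirtBar (fderiv ℝ β z) j) := by
    ext1 <;> refine ContinuousLinearMap.ext fun w => ?_ <;>
      simp [cderiv, complexExt_apply, dzbar]
  simp only [delbarFlat, wedgeOne, h, ← alternatizeUncurryFinCLM_apply, map_sum]

variable (n k) in
/-- The contraction as a continuous bilinear map. -/
def contractL : (CTan n →L[ℂ] CTan n) →L[ℂ] Covec n k →L[ℂ] Covec n k :=
  (fderivCompContinuousLinearMapCLM ℂ (ContinuousLinearMap.id ℂ (CTan n))).flip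

/-- `i_N β` is the derivative at the identity, in the direction `N`, of the pullback `A ↦ A^* β`. -/
theorem contractL_apply (N : CTan n →L[ℂ] CTan n) (β : Covec n k) :
    contractL n k N β = contract N β := by
  ext v
  simp only [contractL, ContinuousLinearMap.flip_apply, fderivCompContinuousLinearMapCLM_apply,
    fderivCompContinuousLinearMap_apply, contract_apply]
  refine Finset.sum_congr rfl fun i _ => congrArg β (funext fun j => ?_)
  by_cases h : j = i
  · subst h; simp
  · simp [h]

/-- `i_N` is a derivation: it hits either the slot fed to `L` or one of the slots of the values of
`L`. Applied to `∂β`, the second term cancels against the part of `∂(i_N β)` in which `β` is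
differentiated. -/
theorem contract_alternatize (N : CTan n →L[ℂ] CTan n) (L : CTan n →L[ℂ] Covec n k) :
    contract N (alternatizeUncurryFin L) =
      alternatizeUncurryFin (L.comp N) + alternatizeUncurryFin ((contractL n k N).comp L) := by
  ext v
  simp only [contract_apply, alternatizeUncurryFin_apply, ContinuousAlternatingMap.add_apply,
    ContinuousLinearMap.comp_apply, contractL_apply]
  rw [Finset.sum_comm, ← Finset.sum_add_distrib]
  refine Finset.sum_congr rfl fun i _ => ?_
  -- The term in which `N` acts on the `i`-th slot, the one fed to `L`, is split off.
  rw [Fin.sum_univ_succAbove _ i]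
  simp only [Function.update_self, Fin.removeNth_update, Fin.removeNth_update_succAbove]
  congr 1
  simp only [Finset.smul_sum]
  refine Finset.sum_congr rfl fun j _ => ?_
  rw [Function.update_of_ne (Fin.succAbove_ne i j).symm]
  rfl

theorem alternatize_compContinuousLinearMap (A : CTan n →L[ℂ] CTan n)
    (L : CTan n →L[ℂ] Covec n k) :
    (alternatizeUncurryFin L).compContinuousLinearMap A =
      alternatizeUncurryFin ((compContinuousLinearMapCLM A).comp (L.comp A)) := by
  ext v
  simp only [compContinuousLinearMap_apply, alternatizeUncurryFin_apply]
  rfl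

/-- The chain rule for `s ↦ (A ∘ (1 + sN))^* γ` at `s = 0`. -/
theorem contract_compContinuousLinearMap (A N : CTan n →L[ℂ] CTan n) (γ : Covec n k) :
    contract N (γ.compContinuousLinearMap A) = γ.fderivCompContinuousLinearMap A (A.comp N) := by
  ext v
  simp only [contract_apply, fderivCompContinuousLinearMap_apply, compContinuousLinearMap_apply]
  refine Finset.sum_congr rfl fun i _ => congrArg γ (funext fun j => ?_)
  by_cases h : j = i
  · subst h; simp
  · simp [h]

/-- The Leibniz rule for a pullback `γ ∘ A`. -/
theorem cderiv_compContinuousLinearMap {γ : Cn n → Covec n k} {A : Cn n → CTan n →L[ℂ] CTan n}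
    {z : Cn n} (hγ : DifferentiableAt ℝ γ z) (hA : DifferentiableAt ℝ A z) (w : CTan n) :
    cderiv (fun y => (γ y).compContinuousLinearMap (A y)) z w =
      (cderiv γ z w).compContinuousLinearMap (A z) +
        (γ z).fderivCompContinuousLinearMap (A z) (cderiv A z w) := by
  have key : cderiv (fun y => (γ y).compContinuousLinearMap (A y)) z =
      (compContinuousLinearMapCLM (A z)).comp (cderiv γ z) +
        ((γ z).fderivCompContinuousLinearMap (A z)).comp (cderiv A z) := by
    refine clm_ext_real fun v => ?_
    rw [cderiv_real]
    have h0 := (hasStrictFDerivAt_compContinuousLinearMap (𝕜 := ℂ) (γ z, A z)).hasFDerivAt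
    have h1 := (h0.restrictScalars ℝ).comp z (hγ.hasFDerivAt.prodMk hA.hasFDerivAt)
    have h2 := DFunLike.congr_fun h1.fderiv v
    simp only [Function.comp_def] at h2
    rw [h2]
    simp [cderiv_real]
  rw [key]
  rfl

set_option maxHeartbeats 1000000 in
/-- If `β = A^* (γ ∘ f)`, where `A = D ∘ E + projZ ∘ D ∘ projZ` for the complexified differential
`D` of `f` and `E = projZbar - N`, and if `∂̄f = ∂f ∘ N`, then `[∂, i_N] β + ∂̄ β` is the pullback
of `∂̄γ` by `A`. -/
theorem delFlat_contract_sub_add_delbarFlat {f : Cn n → Cn n} {N : Cn n → CTan n →L[ℂ] CTan n}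
    {β γ : Cn n → Covec n k} {z₀ : Cn n} (hf : ContDiffAt ℝ ∞ f z₀)
    (hN : DifferentiableAt ℝ N z₀) (hZN : ∀ z, (projZ n).comp (N z) = N z)
    (hNZ : ∀ z, (N z).comp (projZ n) = 0)
    (hfN : ∀ᶠ z in 𝓝 z₀,
      (projZ n).comp ((complexify (fderiv ℝ f z)).comp (projZbar n - N z)) = 0)
    (hinj : ∀ u, (projZ n) u = u → (projZ n) (complexify (fderiv ℝ f z₀) u) = 0 → u = 0)
    (hγ : DifferentiableAt ℝ γ (f z₀))
    (hβ : ∀ᶠ z in 𝓝 z₀, β z = (γ (f z)).compContinuousLinearMap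
      ((complexify (fderiv ℝ f z)).comp (projZbar n - N z) +
        (projZ n).comp ((complexify (fderiv ℝ f z)).comp (projZ n)))) :
    delFlat (fun z => contract (N z) (β z)) z₀ - contract (N z₀) (delFlat β z₀) +
        delbarFlat β z₀ =
      (delbarFlat γ (f z₀)).compContinuousLinearMap
        ((complexify (fderiv ℝ f z₀)).comp (projZbar n - N z₀) +
          (projZ n).comp ((complexify (fderiv ℝ f z₀)).comp (projZ n))) := by
  set D : Cn n → CTan n →L[ℂ] CTan n := fun z => complexify (fderiv ℝ f z) with hDdef
  set A : Cn n → CTan n →L[ℂ] CTan n := fun z => (D z).comp (projZbar n - N z) +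
    (projZ n).comp ((D z).comp (projZ n)) with hAdef
  have hdf : DifferentiableAt ℝ f z₀ := hf.differentiableAt (by simp)
  have hD : DifferentiableAt ℝ D z₀ :=
    (complexifyL n).differentiableAt.comp z₀
      ((hf.fderiv_right (m := 1) (by norm_cast)).differentiableAt (by norm_num))
  have hE : DifferentiableAt ℝ (fun z => projZbar n - N z) z₀ := hN.const_sub _
  let c := ContinuousLinearMap.compL ℂ (CTan n) (CTan n) (CTan n)
  have hbil : ∀ {g h : Cn n → CTan n →L[ℂ] CTan n}, DifferentiableAt ℝ g z₀ →
      DifferentiableAt ℝ h z₀ → DifferentiableAt ℝ (fun z => (g z).comp (h z)) z₀ :=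
    fun hg hh => ((c.bilinearRestrictScalars ℝ).hasFDerivAt_of_bilinear hg.hasFDerivAt
      hh.hasFDerivAt).differentiableAt
  have hcomp : ∀ {g h : Cn n → CTan n →L[ℂ] CTan n}, DifferentiableAt ℝ g z₀ →
      DifferentiableAt ℝ h z₀ → ∀ w, cderiv (fun z => (g z).comp (h z)) z₀ w =
        (cderiv g z₀ w).comp (h z₀) + (g z₀).comp (cderiv h z₀ w) :=
    fun hg hh w => cderiv_bilinear c hg hh w
  have hA : DifferentiableAt ℝ A z₀ :=
    (hbil hD hE).add (hbil (differentiableAt_const _) (hbil hD (differentiableAt_const _)))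
  have hcE : cderiv (fun z => projZbar n - N z) z₀ = -cderiv N z₀ := by
    rw [cderiv_sub (differentiableAt_const _) hN, cderiv_const, zero_sub]
  have hcA : ∀ v w, cderiv A z₀ v w = cderiv D z₀ v ((projZbar n - N z₀) w) -
      D z₀ (cderiv N z₀ v w) + projZ n (cderiv D z₀ v (projZ n w)) := by
    intro v w
    rw [hAdef, cderiv_add (hbil hD hE)
      (hbil (differentiableAt_const _) (hbil hD (differentiableAt_const _))), add_apply,
      hcomp hD hE, hcomp (differentiableAt_const _) (hbil hD (differentiableAt_const _)),
      hcomp hD (differentiableAt_const _), hcE]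
    simp [cderiv_const, sub_eq_add_neg]
  -- Differentiating `P N = N`: the derivatives of `N` again take values in `T^{1,0}`.
  have hcZN : ∀ v w, projZ n (cderiv N z₀ v w) = cderiv N z₀ v w := by
    intro v w
    have h := hcomp (differentiableAt_const (projZ n)) hN v
    simp only [hZN] at h
    have h' := DFunLike.congr_fun h w
    simpa [cderiv_const] using h'.symm
  -- Differentiating `P D E = 0`, where `E = projZbar - N` has derivative `-∇N`.
  have hcfN : ∀ v w, projZ n (D z₀ (cderiv N z₀ v w)) =
      projZ n (cderiv D z₀ v ((projZbar n - N z₀) w)) := by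
    intro v w
    have h := hcomp (differentiableAt_const (projZ n)) (hbil hD hE) v
    rw [cderiv_congr hfN, cderiv_const, hcomp hD hE, hcE] at h
    have h' := DFunLike.congr_fun h w
    simp only [cderiv_const, zero_apply, zero_add, ContinuousLinearMap.zero_comp, neg_apply,
      add_apply, ContinuousLinearMap.comp_apply, map_add, map_neg] at h'
    exact (sub_eq_zero.1 (by rw [h']; abel)).symm
  have hsymm := cderiv_complexify_fderiv_symm hf
  -- Integrability of `N`: after applying `P D`, which is injective on `T^{1,0}`, both sides become
  -- the second derivative of `f` at `E v`, `E w`.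
  have hcNsymm : ∀ v w, cderiv N z₀ ((projZbar n - N z₀) v) w =
      cderiv N z₀ ((projZbar n - N z₀) w) v := by
    intro v w
    refine sub_eq_zero.1 (hinj _ ?_ ?_)
    · rw [map_sub, hcZN, hcZN]
    · change projZ n (D z₀ _) = 0
      rw [map_sub, map_sub, hcfN, hcfN, hsymm, sub_self]
  have hAZ : ∀ u, projZ n u = u → A z₀ u = projZ n (D z₀ u) := by
    intro u hu
    have h1 : (projZbar n - N z₀) u = 0 := by
      have h2 := DFunLike.congr_fun (hNZ z₀) u
      rw [ContinuousLinearMap.comp_apply, hu] at h2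
      rw [sub_apply, h2, ← hu]
      simp
    simp only [hAdef, add_apply, ContinuousLinearMap.comp_apply, h1, hu, map_zero, zero_add]
  -- `K` collects every term of the left side in which `γ` is not differentiated: `A ∘ ∇_P N` from
  -- the commutator with `i_N`, and `∇_E A` from differentiating the pullback.
  let K : CTan n →L[ℂ] CTan n →L[ℂ] CTan n :=
    (c (A z₀)).comp ((cderiv N z₀).comp (projZ n)) + (cderiv A z₀).comp (projZbar n - N z₀)
  have hK : ∀ v w, K v w = K w v := by
    -- In this form exchanging `v` and `w` swaps the two outer terms, while each of the two middle
    -- terms is symmetric by itself.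
    have hKe : ∀ v w, K v w = projZ n (cderiv D z₀ (projZ n v) ((projZbar n - N z₀) w)) +
        (cderiv D z₀ ((projZbar n - N z₀) v) ((projZbar n - N z₀) w) -
          D z₀ (cderiv N z₀ ((projZbar n - N z₀) v) w) +
          projZ n (cderiv D z₀ ((projZbar n - N z₀) v) (projZ n w))) := by
      intro v w
      rw [← hcA, ← hcfN, ← hAZ _ (hcZN _ _)]
      rfl
    intro v w
    rw [hKe, hKe, hcNsymm v w, hsymm (projZ n v), hsymm ((projZbar n - N z₀) v) (projZ n w),
      hsymm ((projZbar n - N z₀) v)]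
    abel
  -- Since `P D E = 0`, differentiating `γ` along `D E` is differentiating it along the `T^{0,1}`
  -- part of `A`: this produces `∂̄γ`.
  have hZbarA : (projZbar n).comp (A z₀) = (D z₀).comp (projZbar n - N z₀) := by
    refine ContinuousLinearMap.ext fun w => ?_
    have h := DFunLike.congr_fun hfN.self_of_nhds w
    have h1 : (D z₀ ((projZbar n - N z₀) w)).1 = 0 := congrArg Prod.fst h
    refine Prod.ext ?_ ?_
    · exact h1.symm
    · change (D z₀ ((projZbar n - N z₀) w)).2 + 0 = _
      rw [add_zero]
      rfl
  have hβ₀ : β z₀ = (γ (f z₀)).compContinuousLinearMap (A z₀) := hβ.self_of_nhds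
  have hγf : DifferentiableAt ℝ (fun z => γ (f z)) z₀ := hγ.comp (f := f) z₀ hdf
  have hcβ : ∀ w, cderiv β z₀ w = (cderiv γ (f z₀) (D z₀ w)).compContinuousLinearMap (A z₀) +
      (γ (f z₀)).fderivCompContinuousLinearMap (A z₀) (cderiv A z₀ w) := by
    intro w
    rw [cderiv_congr hβ, cderiv_compContinuousLinearMap hγf hA, cderiv_comp hγ hdf]
    rfl
  have hβd : DifferentiableAt ℝ β z₀ := by
    have h0 := (hasStrictFDerivAt_compContinuousLinearMap (𝕜 := ℂ) (γ (f z₀), A z₀)).hasFDerivAt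
    have h1 := (h0.restrictScalars ℝ).comp z₀ (hγf.hasFDerivAt.prodMk hA.hasFDerivAt)
    exact h1.differentiableAt.congr_of_eventuallyEq hβ
  have hci : ∀ w, cderiv (fun z => contract (N z) (β z)) z₀ w =
      contract (cderiv N z₀ w) (β z₀) + contract (N z₀) (cderiv β z₀ w) := by
    intro w
    have h := cderiv_bilinear (contractL n k) hN hβd w
    simpa only [contractL_apply] using h
  have h0 := alternatizeUncurryFin_fderivCompContinuousLinearMap_eq_zero (γ (f z₀)) (A z₀) hK
  rw [delFlat_eq, delFlat_eq, delbarFlat_eq, delbarFlat_eq, contract_alternatize]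
  change _ = (alternatizeUncurryFin _).compContinuousLinearMap (A z₀)
  rw [
    alternatize_compContinuousLinearMap, ContinuousLinearMap.comp_assoc (cderiv γ (f z₀)), hZbarA]
  rw [← sub_eq_zero, ← h0]
  simp only [← alternatizeUncurryFinCLM_apply, ← map_add, ← map_sub]
  congr 1
  refine ContinuousLinearMap.ext fun w => ?_
  simp only [sub_apply, add_apply, ContinuousLinearMap.comp_apply, hci,
    contractL_apply]
  have hNw : projZ n (N z₀ w) = N z₀ w := DFunLike.congr_fun (hZN z₀) w
  have e1 : K w = (A z₀).comp (cderiv N z₀ (projZ n w)) +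
    cderiv A z₀ ((projZbar n - N z₀) w) := rfl
  -- `P̄ = N + E`: the `N` part cancels the derivative of `β` along `N` coming from `-i_N ∂β`.
  have e2 : cderiv β z₀ (projZbar n w) = cderiv β z₀ (N z₀ w) +
      cderiv β z₀ ((projZbar n - N z₀) w) := by
    rw [← map_add]; congr 1; simp
  rw [hNw, e1, e2, hcβ ((projZbar n - N z₀) w), hβ₀, contract_compContinuousLinearMap, map_add]
  change _ - (cderiv γ (f z₀) (D z₀ ((projZbar n - N z₀) w))).compContinuousLinearMap (A z₀) = _
  abel

end Flat

/-! ### The Beltrami matrix of a real differential -/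

section Beltrami

open Matrix

variable {n k : ℕ}

/-- The Wirtinger chain rule is the upper left block of the product of two complexified
differentials. -/
theorem wirtMat_comp (L L' : Cn n →L[ℝ] Cn n) :
    wirtMat (L.comp L') = wirtMat L * wirtMat L' + wirtBarMat L * (wirtBarMat L').map star := by
  ext i j
  have h := congrArg (fun T : CTan n →L[ℂ] CTan n => (T (Pi.single j 1, 0)).1 i)
    (complexify_comp L L')
  simpa [complexify_apply, mulVec_mulVec, Matrix.mul_apply, mulVec, dotProduct] using h

theorem wirtBarMat_comp (L L' : Cn n →L[ℝ] Cn n) :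
    wirtBarMat (L.comp L') =
      wirtMat L * wirtBarMat L' + wirtBarMat L * (wirtMat L').map star := by
  ext i j
  have h := congrArg (fun T : CTan n →L[ℂ] CTan n => (T (0, Pi.single j 1)).1 i)
    (complexify_comp L L')
  simpa [complexify_apply, mulVec_mulVec, Matrix.mul_apply, mulVec, dotProduct] using h

theorem wirtMat_id : wirtMat (ContinuousLinearMap.id ℝ (Cn n)) = 1 := by
  ext i j
  have h := congrArg (fun T : CTan n →L[ℂ] CTan n => (T (Pi.single j 1, 0)).1 i)
    (complexify_id (n := n))
  simpa [complexify_apply, Matrix.one_apply, Pi.single_apply] using h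

theorem wirtBarMat_restrictScalars (T : Cn n →L[ℂ] Cn n) :
    wirtBarMat (T.restrictScalars ℝ) = 0 := by
  ext i j
  have h : (Pi.single j Complex.I : Cn n) = Complex.I • (Pi.single j 1 : Cn n) := by
    ext l; simp [Pi.single_apply]
  simp only [wirtBarMat, wirtBar, of_apply, ContinuousLinearMap.coe_restrictScalars', h, map_smul,
    smul_smul, Complex.I_mul_I]
  simp

/-- A complex linear map with a real linear right inverse has an invertible matrix. -/
theorem isUnit_wirtMat {L L' : Cn n →L[ℝ] Cn n} (hL : wirtBarMat L = 0)
    (h : L.comp L' = ContinuousLinearMap.id ℝ (Cn n)) : IsUnit (wirtMat L) := by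
  have h1 := wirtMat_comp L L'
  rw [h, wirtMat_id, hL, Matrix.zero_mul, add_zero] at h1
  exact IsUnit.of_mul_eq_one _ h1.symm

/-- The Beltrami matrix `(∂ζ/∂z)⁻¹ (∂ζ/∂z̄)` of a real differential. -/
def beltramiMat (L : Cn n →L[ℝ] Cn n) : Matrix (Fin n) (Fin n) ℂ := (wirtMat L)⁻¹ * wirtBarMat L

theorem wirtMat_mul_beltramiMat {L : Cn n →L[ℝ] Cn n} (hL : IsUnit (wirtMat L)) :
    wirtMat L * beltramiMat L = wirtBarMat L :=
  Matrix.mul_nonsing_inv_cancel_left _ _ ((Matrix.isUnit_iff_isUnit_det _).1 hL)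

/-- A holomorphic change of `ζ` multiplies `ζ_z` and `ζ_z̄` on the left by the same matrix, which
cancels. So `φ` does not depend on the coordinates chosen on `X_t`. -/
theorem beltramiMat_comp_left {L T : Cn n →L[ℝ] Cn n} (hT : wirtBarMat T = 0)
    (hT' : IsUnit (wirtMat T)) : beltramiMat (T.comp L) = beltramiMat L := by
  have hd := (Matrix.isUnit_iff_isUnit_det _).1 hT'
  rw [beltramiMat, wirtMat_comp, wirtBarMat_comp, hT, Matrix.zero_mul, add_zero, Matrix.zero_mul,
    add_zero, Matrix.mul_inv_rev, Matrix.mul_assoc, Matrix.nonsing_inv_mul_cancel_left _ _ hd,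
    beltramiMat]

theorem isUnit_wirtMat_comp_left {L T : Cn n →L[ℝ] Cn n} (hT : wirtBarMat T = 0)
    (hT' : IsUnit (wirtMat T)) (hL : IsUnit (wirtMat L)) : IsUnit (wirtMat (T.comp L)) := by
  rw [wirtMat_comp, hT, Matrix.zero_mul, add_zero]
  exact hT'.mul hL

theorem isUnit_wirtMat_comp_right {L A : Cn n →L[ℝ] Cn n} (hA : wirtBarMat A = 0)
    (hA' : IsUnit (wirtMat A)) (hL : IsUnit (wirtMat L)) : IsUnit (wirtMat (L.comp A)) := by
  have h0 : (0 : Matrix (Fin n) (Fin n) ℂ).map star = 0 := by ext; simp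
  rw [wirtMat_comp, hA, h0, Matrix.mul_zero, add_zero]
  exact hL.mul hA'

theorem wirtMat_mul_beltramiMat_comp {L A : Cn n →L[ℝ] Cn n} (hA : wirtBarMat A = 0)
    (hA' : IsUnit (wirtMat A)) :
    wirtMat A * beltramiMat (L.comp A) = beltramiMat L * (wirtMat A).map star := by
  have h0 : (0 : Matrix (Fin n) (Fin n) ℂ).map star = 0 := by ext; simp
  have hd := (Matrix.isUnit_iff_isUnit_det _).1 hA'
  rw [beltramiMat, wirtMat_comp, wirtBarMat_comp, hA, h0, Matrix.mul_zero, add_zero,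
    Matrix.mul_zero, zero_add, Matrix.mul_inv_rev, Matrix.mul_assoc,
    Matrix.mul_nonsing_inv_cancel_left _ _ hd, beltramiMat, Matrix.mul_assoc]

/-- The tensor law for `φ` under a holomorphic change of `z`. It lets contraction, extension and
simultaneous contraction commute with passage to local expressions. -/
theorem tensor_comp_complexify {L A : Cn n →L[ℝ] Cn n} (hA : wirtBarMat A = 0)
    (hA' : IsUnit (wirtMat A)) :
    (tensor (beltramiMat L)).comp (complexify A) =
      (complexify A).comp (tensor (beltramiMat (L.comp A))) := by
  have h0 : (0 : Matrix (Fin n) (Fin n) ℂ).map star = 0 := by ext; simp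
  refine ContinuousLinearMap.ext fun w => ?_
  simp only [ContinuousLinearMap.comp_apply, tensor_apply, complexify_apply, hA, h0, mulVec_zero,
    zero_mulVec, zero_add, add_zero, mulVec_mulVec, Matrix.zero_mul,
    wirtMat_mul_beltramiMat_comp hA hA']

theorem map_star_mul (M N : Matrix (Fin n) (Fin n) ℂ) :
    (M * N).map star = M.map star * N.map star := by
  ext i j; simp [Matrix.mul_apply]

theorem tensorBar_comp_complexify {L A : Cn n →L[ℝ] Cn n} (hA : wirtBarMat A = 0)
    (hA' : IsUnit (wirtMat A)) :
    (tensorBar (beltramiMat L)).comp (complexify A) =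
      (complexify A).comp (tensorBar (beltramiMat (L.comp A))) := by
  have h0 : (0 : Matrix (Fin n) (Fin n) ℂ).map star = 0 := by ext; simp
  have h1 : ((wirtMat A).map star).map star = wirtMat A := by ext; simp
  refine ContinuousLinearMap.ext fun w => ?_
  have h := congrArg (fun M => M.map star) (wirtMat_mul_beltramiMat_comp (L := L) hA hA')
  simp only [map_star_mul, h1] at h
  simp only [ContinuousLinearMap.comp_apply, tensorBar_apply, complexify_apply, hA, h0, mulVec_zero,
    zero_mulVec, zero_add, add_zero, mulVec_mulVec, Matrix.zero_mul, h]

theorem extend_compContinuousLinearMap {L A : Cn n →L[ℝ] Cn n} (hA : wirtBarMat A = 0)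
    (hA' : IsUnit (wirtMat A)) (β : Covec n k) :
    (extend (beltramiMat L) β).compContinuousLinearMap (complexify A) =
      extend (beltramiMat (L.comp A)) (β.compContinuousLinearMap (complexify A)) := by
  ext v
  change β _ = β _
  congr 1
  funext i
  have h1 := DFunLike.congr_fun (tensor_comp_complexify (L := L) hA hA') (v i)
  have h2 := DFunLike.congr_fun (tensorBar_comp_complexify (L := L) hA hA') (v i)
  simp only [ContinuousLinearMap.comp_apply] at h1 h2
  simp [h1, h2]

theorem simul_compContinuousLinearMap {L A : Cn n →L[ℝ] Cn n} (hA : wirtBarMat A = 0)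
    (hA' : IsUnit (wirtMat A)) (β : Covec n k) :
    (simul (1 - (tensorBar (beltramiMat L)).comp (tensor (beltramiMat L)))
        β).compContinuousLinearMap (complexify A) =
      simul (1 - (tensorBar (beltramiMat (L.comp A))).comp (tensor (beltramiMat (L.comp A))))
        (β.compContinuousLinearMap (complexify A)) := by
  ext v
  change β _ = β _
  congr 1
  funext i
  have h1 := DFunLike.congr_fun (tensor_comp_complexify (L := L) hA hA') (v i)
  have h2 := DFunLike.congr_fun (tensorBar_comp_complexify (L := L) hA hA')
    (tensor (beltramiMat (L.comp A)) (v i))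
  simp only [ContinuousLinearMap.comp_apply] at h1 h2
  simp [h1, h2]

theorem contract_tensor_compContinuousLinearMap {L A : Cn n →L[ℝ] Cn n} (hA : wirtBarMat A = 0)
    (hA' : IsUnit (wirtMat A)) (β : Covec n k) :
    (contract (tensor (beltramiMat L)) β).compContinuousLinearMap (complexify A) =
      contract (tensor (beltramiMat (L.comp A)))
        (β.compContinuousLinearMap (complexify A)) := by
  ext v
  simp only [ContinuousAlternatingMap.compContinuousLinearMap_apply, contract_apply]
  refine Finset.sum_congr rfl fun i _ => ?_
  congr 1
  funext j
  have h1 := DFunLike.congr_fun (tensor_comp_complexify (L := L) hA hA') (v i)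
  simp only [ContinuousLinearMap.comp_apply] at h1
  by_cases h : j = i
  · subst h; simp [h1]
  · simp [h]

theorem projZ_comp_tensor (M : Matrix (Fin n) (Fin n) ℂ) :
    (projZ n).comp (tensor M) = tensor M :=
  ContinuousLinearMap.ext fun w => by simp [tensor_apply]

theorem tensor_comp_projZ (M : Matrix (Fin n) (Fin n) ℂ) :
    (tensor M).comp (projZ n) = 0 :=
  ContinuousLinearMap.ext fun w => by simp [tensor_apply]

theorem projZ_comp_complexify_comp {L : Cn n →L[ℝ] Cn n} (hL : IsUnit (wirtMat L)) :
    (projZ n).comp ((complexify L).comp (projZbar n - tensor (beltramiMat L))) = 0 := by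
  refine ContinuousLinearMap.ext fun w => Prod.ext ?_ rfl
  simp [complexify_apply, tensor_apply, mulVec_mulVec, wirtMat_mul_beltramiMat hL]

theorem eq_zero_of_projZ_complexify {L : Cn n →L[ℝ] Cn n} (hL : IsUnit (wirtMat L)) {u : CTan n}
    (hu : projZ n u = u) (h : projZ n (complexify L u) = 0) : u = 0 := by
  rw [← hu] at h ⊢
  have h1 : (wirtMat L).mulVec u.1 = 0 := by
    simpa [complexify_apply] using congrArg Prod.fst h
  rw [projZ_apply, (Matrix.mulVec_injective_of_isUnit hL) (h1.trans (mulVec_zero _).symm)]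
  rfl

/-! ### Factorization of the complexified differential through its diagonal blocks -/

/-- The endomorphism of `T^{1,0} ⊕ T^{0,1}` with the diagonal blocks `∂ζ/∂z` and its conjugate. -/
def diagPart (L : Cn n →L[ℝ] Cn n) : CTan n →L[ℂ] CTan n :=
  (projZ n).comp ((complexify L).comp (projZ n)) +
    (projZbar n).comp ((complexify L).comp (projZbar n))

theorem diagPart_apply (L : Cn n →L[ℝ] Cn n) (w : CTan n) :
    diagPart L w = ((wirtMat L).mulVec w.1, ((wirtMat L).map star).mulVec w.2) := by
  simp [diagPart, complexify_apply]

theorem wirtBarMat_map_star {L : Cn n →L[ℝ] Cn n} (hL : IsUnit (wirtMat L)) :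
    (wirtBarMat L).map star = (wirtMat L).map star * (beltramiMat L).map star := by
  rw [← map_star_mul, wirtMat_mul_beltramiMat hL]

theorem complexify_eq_diagPart_comp {L : Cn n →L[ℝ] Cn n} (hL : IsUnit (wirtMat L)) :
    complexify L = (diagPart L).comp
      (1 + tensor (beltramiMat L) + tensorBar (beltramiMat L)) := by
  refine ContinuousLinearMap.ext fun w => ?_
  simp [complexify_apply, tensor_apply, tensorBar_apply, diagPart_apply,
    mulVec_mulVec, wirtMat_mul_beltramiMat hL, wirtBarMat_map_star hL, add_comm,
    -RCLike.star_def, -Complex.star_def]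

theorem complexify_comp_sub_add {L : Cn n →L[ℝ] Cn n} (hL : IsUnit (wirtMat L)) :
    (complexify L).comp (projZbar n - tensor (beltramiMat L)) +
        (projZ n).comp ((complexify L).comp (projZ n)) =
      (diagPart L).comp
        (1 - (tensorBar (beltramiMat L)).comp (tensor (beltramiMat L))) := by
  refine ContinuousLinearMap.ext fun w => ?_
  refine Prod.ext ?_ ?_ <;>
    simp [complexify_apply, tensor_apply, tensorBar_apply, diagPart_apply, mulVec_mulVec, wirtMat_mul_beltramiMat hL, wirtBarMat_map_star hL,
      Matrix.mul_assoc, sub_eq_add_neg, -RCLike.star_def, -Complex.star_def, add_comm]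

/-- The preimage of a vector of pure type can be taken of the same type, which is what the
preservation of `(p,q)`-types needs. -/
theorem surjective_diagPart {L : Cn n →L[ℝ] Cn n} (hL : IsUnit (wirtMat L)) (w : CTan n) :
    ∃ w', diagPart L w' = w ∧ (w.1 = 0 → w'.1 = 0) ∧ (w.2 = 0 → w'.2 = 0) := by
  have hs : IsUnit ((wirtMat L).map star) := by
    have := hL.map (RingHom.mapMatrix (starRingEnd ℂ))
    exact this
  refine ⟨((wirtMat L)⁻¹.mulVec w.1, (((wirtMat L).map star)⁻¹).mulVec w.2), ?_, ?_, ?_⟩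
  · rw [diagPart_apply, mulVec_mulVec, mulVec_mulVec,
      Matrix.mul_nonsing_inv _ ((Matrix.isUnit_iff_isUnit_det _).1 hL),
      Matrix.mul_nonsing_inv _ ((Matrix.isUnit_iff_isUnit_det _).1 hs), one_mulVec, one_mulVec]
  · intro h; simp [h]
  · intro h; simp [h]

/-! ### Pullbacks when the real differential is invertible -/

section Invertible

variable {L L' : Cn n →L[ℝ] Cn n}

theorem complexify_leftInverse (h : L'.comp L = ContinuousLinearMap.id ℝ (Cn n)) (w : CTan n) :
    complexify L' (complexify L w) = w := by
  rw [← ContinuousLinearMap.comp_apply, ← complexify_comp, h, complexify_id]; rfl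

/-- Composed with the diagonal part, `1 + φ + φ̄` is the left invertible `complexify L`, so it is
injective, and surjective by finite dimension. -/
theorem surjective_extension (hL : IsUnit (wirtMat L))
    (h : L'.comp L = ContinuousLinearMap.id ℝ (Cn n)) :
    Function.Surjective
      (1 + tensor (beltramiMat L) + tensorBar (beltramiMat L) : CTan n →L[ℂ] CTan n) := by
  set P : CTan n →L[ℂ] CTan n := 1 + tensor (beltramiMat L) + tensorBar (beltramiMat L)
  refine (LinearMap.injective_iff_surjective (f := (P : CTan n →ₗ[ℂ] CTan n))).1 fun v w hvw => ?_
  rw [← complexify_leftInverse h v, ← complexify_leftInverse h w, complexify_eq_diagPart_comp hL]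
  exact congrArg (fun u => complexify L' (diagPart L u)) hvw

theorem surjective_one_sub (hL : IsUnit (wirtMat L))
    (h : L'.comp L = ContinuousLinearMap.id ℝ (Cn n)) :
    Function.Surjective (1 - (tensorBar (beltramiMat L)).comp (tensor (beltramiMat L)) :
      CTan n →L[ℂ] CTan n) := by
  set φ := beltramiMat L
  set S : CTan n →L[ℂ] CTan n := 1 - (tensorBar φ).comp (tensor φ)
  set P : CTan n →L[ℂ] CTan n := 1 + tensor φ + tensorBar φ with hP
  have hPi : Function.Injective P :=
    (LinearMap.injective_iff_surjective (f := (P : CTan n →ₗ[ℂ] CTan n))).2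
      (surjective_extension hL h)
  refine (LinearMap.injective_iff_surjective (f := (S : CTan n →ₗ[ℂ] CTan n))).1 ?_
  refine (injective_iff_map_eq_zero _).2 fun w hw => ?_
  have h1 : w - tensorBar φ (tensor φ w) = 0 := hw
  rw [tensor_apply, tensorBar_apply] at h1
  have h2 : w.1 = 0 := by simpa using congrArg Prod.fst h1
  have h3 : w.2 - (φ.map star).mulVec (φ.mulVec w.2) = 0 := by simpa using congrArg Prod.snd h1
  -- A kernel vector of `1 - φ̄φ` yields one of `1 + φ + φ̄`, already known to be injective; no
  -- bound on the size of `φ` enters.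
  have h4 : P (-(φ.mulVec w.2), w.2) = 0 := by
    simp only [hP, _root_.add_apply, tensor_apply, tensorBar_apply, one_apply_eq_self]
    refine Prod.ext ?_ ?_
    · simp
    · simpa [mulVec_neg, sub_eq_add_neg] using h3
  have h5 : ((-(φ.mulVec w.2), w.2) : CTan n) = 0 := hPi (h4.trans (map_zero P).symm)
  exact Prod.ext h2 (Prod.ext_iff.1 h5).2

theorem compContinuousLinearMap_injective {A : CTan n →L[ℂ] CTan n} (hA : Function.Surjective A)
    {β γ : Covec n k} (h : β.compContinuousLinearMap A = γ.compContinuousLinearMap A) : β = γ := by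
  ext v
  choose u hu using fun i => hA (v i)
  have := DFunLike.congr_fun h u
  simpa [Function.comp_def, hu] using this

/-- A covector whose pullback by the complexification of `L` is an extension `e^{i_φ|i_φ̄} α`. -/
theorem eq_comp_diagPart (hL : IsUnit (wirtMat L))
    (h : L'.comp L = ContinuousLinearMap.id ℝ (Cn n)) {α γ : Covec n k}
    (e : γ.compContinuousLinearMap (complexify L) = extend (beltramiMat L) α) :
    α = γ.compContinuousLinearMap (diagPart L) := by
  -- Both sides have the same pullback by the surjective map `1 + φ + φ̄`.
  refine compContinuousLinearMap_injective (surjective_extension hL h) ?_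
  refine Eq.trans (Eq.symm ?_) (congrArg (γ.compContinuousLinearMap)
    (complexify_eq_diagPart_comp hL))
  exact e

/-- By `eq_comp_diagPart`, `α` is the pullback of `γ` by a bijection respecting `T^{1,0}` and
`T^{0,1}`, so vectors of pure type testing `γ` lift to vectors testing `α`. -/
theorem isType_of_comp_complexify (hL : IsUnit (wirtMat L))
    (h : L'.comp L = ContinuousLinearMap.id ℝ (Cn n)) {α γ : Covec n k} {p q : ℕ}
    (hα : IsType p q α)
    (e : γ.compContinuousLinearMap (complexify L) = extend (beltramiMat L) α) :
    IsType p q γ := by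
  refine ⟨hα.1, fun S w h1 h2 h3 => ?_⟩
  choose u hu h1' h2' using fun i => surjective_diagPart hL (w i)
  have h4 := hα.2 S u (fun i hi => h2' i (h1 i hi)) (fun i hi => h1' i (h2 i hi)) h3
  rw [eq_comp_diagPart hL h e] at h4
  simpa [Function.comp_def, hu] using h4

end Invertible

end Beltrami

/-! ### Smoothness -/

section Smoothness

open ContinuousMultilinearMap (compContinuousLinearMapContinuousMultilinear)

variable {n k : ℕ} {E : Type*} [NormedAddCommGroup E] [NormedSpace ℝ E] {z₀ : E}

variable (n k) in
/-- The alternatization of multilinear forms as a continuous linear map. -/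
def alternatizationL : ContinuousMultilinearMap ℂ (fun _ : Fin k => CTan n) ℂ →L[ℂ] Covec n k :=
  LinearMap.mkContinuous
    { toFun := ContinuousMultilinearMap.alternatization
      map_add' := map_add _
      map_smul' := fun c m => by
        ext v
        simp [ContinuousMultilinearMap.alternatization_apply_apply, Finset.mul_sum,
          Units.smul_def, mul_left_comm] } (k.factorial : ℝ) fun m => by
    refine ContinuousAlternatingMap.opNorm_le_bound _ (by positivity) fun v => ?_
    have h : ∀ σ : Equiv.Perm (Fin k), ‖Equiv.Perm.sign σ • m fun i => v (σ i)‖ ≤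
        ‖m‖ * ∏ i, ‖v i‖ := by
      intro σ
      rw [← Equiv.prod_comp σ fun i => ‖v i‖]
      refine le_trans (le_of_eq ?_) (m.le_opNorm fun i => v (σ i))
      rcases Int.units_eq_one_or (Equiv.Perm.sign σ) with hs | hs <;> simp [hs]
    change ‖ContinuousMultilinearMap.alternatization m v‖ ≤ _
    rw [ContinuousMultilinearMap.alternatization_apply_apply]
    refine (norm_sum_le_of_le _ fun σ _ => h σ).trans (le_of_eq ?_)
    simp [Finset.card_univ, Fintype.card_perm, mul_assoc]

/-- Divided by `k!`, alternatization is a linear retraction onto alternating forms; smoothness can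
therefore be tested among multilinear forms. -/
theorem alternatizationL_coe (β : Covec n k) :
    alternatizationL n k β.toContinuousMultilinearMap = (k.factorial : ℂ) • β := by
  ext v
  change ContinuousMultilinearMap.alternatization _ v = _
  rw [ContinuousMultilinearMap.alternatization_apply_apply]
  have h : ∀ σ : Equiv.Perm (Fin k), Equiv.Perm.sign σ • β.toContinuousMultilinearMap
      (fun i => v (σ i)) = β v := by
    intro σ
    have h1 := β.toAlternatingMap.map_perm v σ
    change Equiv.Perm.sign σ • β.toAlternatingMap (v ∘ σ) = _
    rw [h1, smul_smul, Int.units_mul_self, one_smul]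
    rfl
  refine (Finset.sum_congr rfl fun σ _ => h σ).trans ?_
  simp [Finset.card_univ, Fintype.card_perm]

/-- A covector-valued map is smooth if it is so as a map into multilinear forms. -/
theorem contDiffAt_of_toContinuousMultilinearMap {β : E → Covec n k}
    (h : ContDiffAt ℝ ∞ (fun z => (β z).toContinuousMultilinearMap) z₀) :
    ContDiffAt ℝ ∞ β z₀ := by
  have h1 := ((alternatizationL n k).restrictScalars ℝ).contDiff.contDiffAt.comp z₀ h
  have h2 := h1.const_smul ((k.factorial : ℂ)⁻¹)
  refine h2.congr_of_eventuallyEq (Filter.Eventually.of_forall fun z => ?_)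
  have hk : (k.factorial : ℂ) ≠ 0 := by exact_mod_cast k.factorial_ne_zero
  change β z = (k.factorial : ℂ)⁻¹ • alternatizationL n k (β z).toContinuousMultilinearMap
  rw [alternatizationL_coe, smul_smul, inv_mul_cancel₀ hk, one_smul]

theorem ContDiffAt.covec_comp {β : E → Covec n k} {A : E → CTan n →L[ℂ] CTan n}
    (hβ : ContDiffAt ℝ ∞ β z₀) (hA : ContDiffAt ℝ ∞ A z₀) :
    ContDiffAt ℝ ∞ (fun z => (β z).compContinuousLinearMap (A z)) z₀ := by
  refine contDiffAt_of_toContinuousMultilinearMap ?_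
  -- Pullback is the diagonal restriction of a map multilinear in `k` endomorphisms, hence smooth in
  -- `A`.
  let Q := compContinuousLinearMapContinuousMultilinear ℂ (fun _ : Fin k => CTan n)
    (fun _ : Fin k => CTan n) ℂ
  have hQ : ContDiff ℂ ∞ fun A : Fin k → CTan n →L[ℂ] CTan n => Q A :=
    ContinuousMultilinearMap.contDiff (𝕜 := ℂ) (E := fun _ : Fin k => CTan n →L[ℂ] CTan n)
      (F := ContinuousMultilinearMap ℂ (fun _ : Fin k => CTan n) ℂ →L[ℂ]
        ContinuousMultilinearMap ℂ (fun _ : Fin k => CTan n) ℂ) Q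
  have h1 : ContDiffAt ℝ ∞ (fun z => Q fun _ => A z) z₀ :=
    (hQ.restrict_scalars ℝ).contDiffAt.comp z₀ (contDiffAt_pi.2 fun _ => hA)
  have h2 : ContDiffAt ℝ ∞ (fun z => (β z).toContinuousMultilinearMap) z₀ :=
    ((ContinuousAlternatingMap.toContinuousMultilinearMapCLM (𝕜 := ℂ) (E := CTan n) (F := ℂ)
      (ι := Fin k) ℂ).restrictScalars ℝ).contDiff.contDiffAt.comp z₀ hβ
  let a := ContinuousLinearMap.id ℂ
    (ContinuousMultilinearMap ℂ (fun _ : Fin k => CTan n) ℂ →L[ℂ]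
      ContinuousMultilinearMap ℂ (fun _ : Fin k => CTan n) ℂ)
  exact (a.bilinearRestrictScalars ℝ).isBoundedBilinearMap.contDiff.contDiffAt.comp z₀
    (h1.prodMk h2)

theorem contDiffAt_det {M : E → Matrix (Fin n) (Fin n) ℂ}
    (h : ∀ i j, ContDiffAt ℝ ∞ (fun z => M z i j) z₀) :
    ContDiffAt ℝ ∞ (fun z => (M z).det) z₀ := by
  simp only [Matrix.det_apply]
  refine ContDiffAt.sum fun σ _ => ContDiffAt.const_smul _ ?_
  exact contDiffAt_prod fun i _ => h _ _

/-- Cramer's rule, entry by entry. -/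
theorem contDiffAt_inv {M : E → Matrix (Fin n) (Fin n) ℂ}
    (h : ∀ i j, ContDiffAt ℝ ∞ (fun z => M z i j) z₀) (hu : IsUnit (M z₀)) (i j : Fin n) :
    ContDiffAt ℝ ∞ (fun z => (M z)⁻¹ i j) z₀ := by
  have hd : (M z₀).det ≠ 0 := ((Matrix.isUnit_iff_isUnit_det _).1 hu).ne_zero
  simp only [Matrix.inv_def, Matrix.smul_apply, Ring.inverse_eq_inv', smul_eq_mul,
    Matrix.adjugate_apply]
  refine ((contDiffAt_det h).inv hd).mul (contDiffAt_det fun a b => ?_)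
  by_cases hab : a = j
  · subst hab
    simpa using contDiffAt_const
  · simpa [Matrix.updateRow_ne hab] using h a b

theorem contDiffAt_tensor {M : E → Matrix (Fin n) (Fin n) ℂ}
    (h : ∀ i j, ContDiffAt ℝ ∞ (fun z => M z i j) z₀) :
    ContDiffAt ℝ ∞ (fun z => tensor (M z)) z₀ := by
  have e : ∀ z, tensor (M z) = ∑ i, ∑ j, M z i j • (dzbar j).smulRight (vecZ (n := n) i) := by
    intro z
    refine ContinuousLinearMap.ext fun w => ?_
    simp [tensor, smul_smul, mul_comm]
  simp only [e]
  exact ContDiffAt.sum fun i _ => ContDiffAt.sum fun j _ => (h i j).smul contDiffAt_const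

theorem contDiffAt_tensorBar {M : E → Matrix (Fin n) (Fin n) ℂ}
    (h : ∀ i j, ContDiffAt ℝ ∞ (fun z => M z i j) z₀) :
    ContDiffAt ℝ ∞ (fun z => tensorBar (M z)) z₀ := by
  have e : ∀ z, tensorBar (M z) =
      ∑ i, ∑ j, star (M z i j) • (dz j).smulRight (vecZbar (n := n) i) := by
    intro z
    refine ContinuousLinearMap.ext fun w => ?_
    simp [tensorBar, smul_smul, mul_comm]
  simp only [e]
  exact ContDiffAt.sum fun i _ => ContDiffAt.sum fun j _ =>
    ((starL' ℝ : ℂ ≃L[ℝ] ℂ).contDiff.contDiffAt.comp z₀ (h i j)).smul contDiffAt_const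

theorem contDiffAt_wirtMat {L : E → Cn n →L[ℝ] Cn n} (hL : ContDiffAt ℝ ∞ L z₀) (i j : Fin n) :
    ContDiffAt ℝ ∞ (fun z => wirtMat (L z) i j) z₀ := by
  have h : ∀ v, ContDiffAt ℝ ∞ (fun z => L z v i) z₀ := fun v =>
    contDiffAt_pi.1 (hL.clm_apply contDiffAt_const) i
  simp only [wirtMat, wirt, Matrix.of_apply, Pi.smul_apply, Pi.sub_apply]
  exact ((h _).sub ((h _).const_smul _)).const_smul _

theorem contDiffAt_wirtBarMat {L : E → Cn n →L[ℝ] Cn n} (hL : ContDiffAt ℝ ∞ L z₀)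
    (i j : Fin n) : ContDiffAt ℝ ∞ (fun z => wirtBarMat (L z) i j) z₀ := by
  have h : ∀ v, ContDiffAt ℝ ∞ (fun z => L z v i) z₀ := fun v =>
    contDiffAt_pi.1 (hL.clm_apply contDiffAt_const) i
  simp only [wirtBarMat, wirtBar, Matrix.of_apply, Pi.smul_apply, Pi.add_apply]
  exact ((h _).add ((h _).const_smul _)).const_smul _

theorem contDiffAt_beltramiMat {L : E → Cn n →L[ℝ] Cn n} (hL : ContDiffAt ℝ ∞ L z₀)
    (hu : IsUnit (wirtMat (L z₀))) (i j : Fin n) :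
    ContDiffAt ℝ ∞ (fun z => beltramiMat (L z) i j) z₀ := by
  simp only [beltramiMat, Matrix.mul_apply]
  exact ContDiffAt.sum fun l _ => (contDiffAt_inv (contDiffAt_wirtMat hL) hu i l).mul
    (contDiffAt_wirtBarMat hL l j)

theorem contDiffAt_complexify {L : E → Cn n →L[ℝ] Cn n} (hL : ContDiffAt ℝ ∞ L z₀) :
    ContDiffAt ℝ ∞ (fun z => complexify (L z)) z₀ :=
  (complexifyL n).contDiff.contDiffAt.comp z₀ hL

theorem contDiffAt_extend {L : E → Cn n →L[ℝ] Cn n} {α : E → Covec n k}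
    (hL : ContDiffAt ℝ ∞ L z₀) (hu : IsUnit (wirtMat (L z₀))) (hα : ContDiffAt ℝ ∞ α z₀) :
    ContDiffAt ℝ ∞ (fun z => extend (beltramiMat (L z)) (α z)) z₀ :=
  ContDiffAt.covec_comp hα ((contDiffAt_const.add (contDiffAt_tensor
    (contDiffAt_beltramiMat hL hu))).add (contDiffAt_tensorBar (contDiffAt_beltramiMat hL hu)))

end Smoothness

/-- The equivalence of the two equations in local coordinates: `f` is the expression of holomorphic
coordinates of `X_t` in those of `X_0`. -/
theorem delbarFlat_eq_zero_iff {n k : ℕ} {f : Cn n → Cn n} {z₀ : Cn n} {α β γ : Cn n → Covec n k}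
    (hf : ContDiffAt ℝ ∞ f z₀)
    (hu : ∀ᶠ z in 𝓝 z₀, IsUnit (wirtMat (fderiv ℝ f z)))
    (hinv : ∀ᶠ z in 𝓝 z₀, ∃ L : Cn n →L[ℝ] Cn n,
      L.comp (fderiv ℝ f z) = ContinuousLinearMap.id ℝ (Cn n))
    (hγ : DifferentiableAt ℝ γ (f z₀))
    (hγα : ∀ᶠ z in 𝓝 z₀, (γ (f z)).compContinuousLinearMap (complexify (fderiv ℝ f z)) =
      extend (beltramiMat (fderiv ℝ f z)) (α z))
    (hβ : ∀ᶠ z in 𝓝 z₀, β z = simul (1 - (tensorBar (beltramiMat (fderiv ℝ f z))).comp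
      (tensor (beltramiMat (fderiv ℝ f z)))) (α z)) :
    delbarFlat γ (f z₀) = 0 ↔
      delFlat (fun z => contract (tensor (beltramiMat (fderiv ℝ f z))) (β z)) z₀ -
        contract (tensor (beltramiMat (fderiv ℝ f z₀))) (delFlat β z₀) + delbarFlat β z₀ = 0 := by
  have hL : ContDiffAt ℝ ∞ (fderiv ℝ f) z₀ := hf.fderiv_right (by simp)
  have hu₀ := hu.self_of_nhds
  have hN : ContDiffAt ℝ ∞ (fun z => tensor (beltramiMat (fderiv ℝ f z))) z₀ :=
    contDiffAt_tensor (contDiffAt_beltramiMat hL hu₀)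
  rw [delFlat_contract_sub_add_delbarFlat (f := f) (γ := γ) hf (hN.differentiableAt (by simp))
    (fun z => projZ_comp_tensor _) (fun z => tensor_comp_projZ _)
    (hu.mono fun z hz => projZ_comp_complexify_comp hz)
    (fun u h1 h2 => eq_zero_of_projZ_complexify hu₀ h1 h2) hγ ?_,
    complexify_comp_sub_add hu₀]
  · refine ⟨fun h => by rw [h]; rfl, fun h => ?_⟩
    obtain ⟨L, hL⟩ := hinv.self_of_nhds
    refine compContinuousLinearMap_injective (A := (diagPart (fderiv ℝ f z₀)).comp
      (1 - (tensorBar (beltramiMat (fderiv ℝ f z₀))).comp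
        (tensor (beltramiMat (fderiv ℝ f z₀))))) ?_ (h.trans rfl)
    -- Surjectivity of `A = Δ ∘ (1 - φ̄φ)` makes `A^*` injective, which gives the converse
    -- implication.
    refine Function.Surjective.comp (g := diagPart (fderiv ℝ f z₀)) (fun w => ?_)
      (surjective_one_sub hu₀ hL)
    obtain ⟨w', hw', -⟩ := surjective_diagPart hu₀ w
    exact ⟨w', hw'⟩
  · filter_upwards [hu, hinv, hγα, hβ] with z h1 h2 h3 h4
    obtain ⟨L, hL⟩ := h2
    rw [complexify_comp_sub_add h1, h4, eq_comp_diagPart h1 hL h3]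
    rfl

/-! ### Smooth coordinate systems -/

theorem covec_comp_comp {n k : ℕ} (β : Covec n k) (A A' : CTan n →L[ℂ] CTan n) :
    (β.compContinuousLinearMap A).compContinuousLinearMap A' =
      β.compContinuousLinearMap (A.comp A') := by
  ext v
  rfl

section SmoothCoordinates

open Set

variable {n : ℕ} {X : Type*} [TopologicalSpace X] [ChartedSpace (Cn n) X]

/-- Coordinate systems that are diffeomorphisms onto open sets of `ℂⁿ`. -/
structure IsSmoothCoord (e : OpenPartialHomeomorph X (Cn n)) : Prop where
  contMDiffOn : ContMDiffOn 𝓘(ℝ, Cn n) 𝓘(ℝ, Cn n) ∞ e e.source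
  contMDiffOn_symm : ContMDiffOn 𝓘(ℝ, Cn n) 𝓘(ℝ, Cn n) ∞ e.symm e.target

/-- The real differential of the coordinate change from `e` to `e'`. -/
def dTrans (e e' : OpenPartialHomeomorph X (Cn n)) (z : Cn n) : Cn n →L[ℝ] Cn n :=
  fderiv ℝ (fun w => e' (e.symm w)) z

variable {e e' e'' : OpenPartialHomeomorph X (Cn n)} {z : Cn n}

omit [ChartedSpace (Cn n) X] in
theorem eventually_mem_target (hz : z ∈ e.target) (hz' : e.symm z ∈ e'.source) :
    ∀ᶠ w in 𝓝 z, w ∈ e.target ∧ e.symm w ∈ e'.source :=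
  ((e.open_target.eventually_mem hz).and
    ((e.continuousAt_symm hz).eventually (e'.open_source.eventually_mem hz')))

theorem IsSmoothCoord.contDiffAt (he : IsSmoothCoord e) (he' : IsSmoothCoord e')
    (hz : z ∈ e.target) (hz' : e.symm z ∈ e'.source) :
    ContDiffAt ℝ ∞ (fun w => e' (e.symm w)) z := by
  have h1 := he.contMDiffOn_symm.contMDiffAt (e.open_target.mem_nhds hz)
  have h2 := he'.contMDiffOn.contMDiffAt (e'.open_source.mem_nhds hz')
  exact contMDiffAt_iff_contDiffAt.1 (h2.comp z h1)

theorem IsSmoothCoord.contDiffAt_dTrans (he : IsSmoothCoord e) (he' : IsSmoothCoord e')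
    (hz : z ∈ e.target) (hz' : e.symm z ∈ e'.source) : ContDiffAt ℝ ∞ (dTrans e e') z :=
  (he.contDiffAt he' hz hz').fderiv_right (by simp)

theorem dTrans_comp (he : IsSmoothCoord e) (he' : IsSmoothCoord e') (he'' : IsSmoothCoord e'')
    (hz : z ∈ e.target) (hz' : e.symm z ∈ e'.source) (hz'' : e.symm z ∈ e''.source) :
    dTrans e e'' z = (dTrans e' e'' (e' (e.symm z))).comp (dTrans e e' z) := by
  have h0 : e'.symm (e' (e.symm z)) = e.symm z := e'.left_inv hz'
  have h1 : DifferentiableAt ℝ (fun w => e' (e.symm w)) z :=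
    (he.contDiffAt he' hz hz').differentiableAt (by simp)
  have h2 : DifferentiableAt ℝ (fun w => e'' (e'.symm w)) (e' (e.symm z)) :=
    (he'.contDiffAt he'' (e'.map_source hz') (by rwa [h0])).differentiableAt (by simp)
  rw [dTrans, dTrans, dTrans, ← fderiv_comp z h2 h1]
  refine Filter.EventuallyEq.fderiv_eq ?_
  filter_upwards [eventually_mem_target hz hz'] with w hw
  simp [e'.left_inv hw.2]

omit [ChartedSpace (Cn n) X] in
theorem dTrans_self (hz : z ∈ e.target) : dTrans e e z = ContinuousLinearMap.id ℝ (Cn n) := by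
  rw [dTrans, ← fderiv_id (𝕜 := ℝ) (x := z)]
  refine Filter.EventuallyEq.fderiv_eq ?_
  filter_upwards [e.open_target.eventually_mem hz] with w hw
  simp [e.right_inv hw]

theorem dTrans_comp_dTrans (he : IsSmoothCoord e) (he' : IsSmoothCoord e')
    (hz : z ∈ e.target) (hz' : e.symm z ∈ e'.source) :
    (dTrans e' e (e' (e.symm z))).comp (dTrans e e' z) = ContinuousLinearMap.id ℝ (Cn n) := by
  rw [← dTrans_comp he he' he hz hz' (e.map_target hz), dTrans_self hz]

theorem dTrans_comp_dTrans' (he : IsSmoothCoord e) (he' : IsSmoothCoord e')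
    (hz : z ∈ e.target) (hz' : e.symm z ∈ e'.source) :
    (dTrans e e' z).comp (dTrans e' e (e' (e.symm z))) = ContinuousLinearMap.id ℝ (Cn n) := by
  have h0 : e'.symm (e' (e.symm z)) = e.symm z := e'.left_inv hz'
  have h := dTrans_comp_dTrans he' he (e'.map_source hz') (by rw [h0]; exact e.map_target hz)
  rwa [h0, e.right_inv hz] at h

/-- The manifold derivative is computed in the preferred chart at `x`, so it is an ordinary
coordinate change. -/
theorem dCoord_eq (he : IsSmoothCoord e) {x : X} (hx : x ∈ e.source) :
    dCoord e x = dTrans (chartAt (Cn n) x) e (chartAt (Cn n) x x) := by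
  have h := (he.contMDiffOn.contMDiffAt (e.open_source.mem_nhds hx)).mdifferentiableAt (by simp)
  refine h.mfderiv.trans ?_
  rw [modelWithCornersSelf_coe, range_id, fderivWithin_univ]
  rfl

theorem dCoordSymm_eq (he : IsSmoothCoord e) (hz : z ∈ e.target) :
    dCoordSymm e z = dTrans e (chartAt (Cn n) (e.symm z)) z := by
  have h := (he.contMDiffOn_symm.contMDiffAt (e.open_target.mem_nhds hz)).mdifferentiableAt
    (by simp)
  refine h.mfderiv.trans ?_
  rw [modelWithCornersSelf_coe, range_id, fderivWithin_univ]
  rfl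

/-! ### Holomorphic charts of `X` and local expressions of forms -/

section Charts

variable [IsManifold 𝓘(ℂ, Cn n) ω X]

theorem contDiffOn_transition (he : e ∈ atlas (Cn n) X) (he' : e' ∈ atlas (Cn n) X) :
    ContDiffOn ℂ ω (e.symm.trans e') (e.symm.trans e').source :=
  contMDiffOn_iff_contDiffOn.1 (contMDiffOn_of_mem_contDiffGroupoid (I := 𝓘(ℂ, Cn n))
    (HasGroupoid.compatible he he'))

variable (n X) in
/-- A complex manifold is a smooth manifold. -/
theorem isManifold_real : IsManifold 𝓘(ℝ, Cn n) ∞ X := by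
  refine isManifold_of_contDiffOn _ _ _ fun e e' he he' => ?_
  have h := ((contDiffOn_transition he he').restrict_scalars ℝ).of_le (m := ∞) le_top
  simpa using h

theorem isSmoothCoord_of_mem_atlas (he : e ∈ atlas (Cn n) X) : IsSmoothCoord e := by
  have := isManifold_real n X
  have h := IsManifold.subset_maximalAtlas (I := 𝓘(ℝ, Cn n)) (n := ∞) he
  exact ⟨contMDiffOn_of_mem_maximalAtlas h, contMDiffOn_symm_of_mem_maximalAtlas h⟩

theorem isSmoothCoord_chartAt (x : X) : IsSmoothCoord (chartAt (Cn n) x) :=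
  isSmoothCoord_of_mem_atlas (chart_mem_atlas _ x)

theorem wirtBarMat_dTrans (he : e ∈ atlas (Cn n) X) (he' : e' ∈ atlas (Cn n) X)
    (hz : z ∈ e.target) (hz' : e.symm z ∈ e'.source) : wirtBarMat (dTrans e e' z) = 0 := by
  have h := contDiffOn_transition he he'
  have h1 : DifferentiableAt ℂ (fun w => e' (e.symm w)) z :=
    (h.contDiffAt (IsOpen.mem_nhds (e.symm.trans e').open_source
      ⟨hz, hz'⟩)).differentiableAt (by simp)
  rw [dTrans, h1.fderiv_restrictScalars ℝ]
  exact wirtBarMat_restrictScalars _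

theorem isUnit_wirtMat_dTrans (he : e ∈ atlas (Cn n) X) (he' : e' ∈ atlas (Cn n) X)
    (hz : z ∈ e.target) (hz' : e.symm z ∈ e'.source) : IsUnit (wirtMat (dTrans e e' z)) :=
  isUnit_wirtMat (wirtBarMat_dTrans he he' hz hz') (dTrans_comp_dTrans'
    (isSmoothCoord_of_mem_atlas he) (isSmoothCoord_of_mem_atlas he') hz hz')

variable {k : ℕ}

/-- The change of coordinates for local expressions of forms. -/
theorem localRep_eq (he : IsSmoothCoord e) (he' : IsSmoothCoord e') (hz : z ∈ e.target)
    (hz' : e.symm z ∈ e'.source) (β : KForm n X k) :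
    localRep e β z =
      (localRep e' β (e' (e.symm z))).compContinuousLinearMap (complexify (dTrans e e' z)) := by
  have h0 : e'.symm (e' (e.symm z)) = e.symm z := e'.left_inv hz'
  rw [localRep, localRep, dCoordSymm_eq he hz, dCoordSymm_eq he' (e'.map_source hz'), h0,
    dTrans_comp he he' (isSmoothCoord_chartAt _) hz hz' (mem_chart_source _ _), complexify_comp,
    covec_comp_comp]

/-- Smoothness is required only in the charts of `X`; this transfers it to the coordinates of `X_t`.
-/
theorem IsSmooth.contDiffAt_localRep {β : KForm n X k} (hβ : IsSmooth β) (he : IsSmoothCoord e)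
    (hz : z ∈ e.target) : ContDiffAt ℝ ∞ (localRep e β) z := by
  set c := chartAt (Cn n) (e.symm z)
  have hc : IsSmoothCoord c := isSmoothCoord_chartAt _
  have hzc : e.symm z ∈ c.source := mem_chart_source _ _
  have h1 : ContDiffAt ℝ ∞ (localRep c β) (c (e.symm z)) :=
    (hβ c (chart_mem_atlas _ _)).contDiffAt (c.open_target.mem_nhds (c.map_source hzc))
  have h2 := ContDiffAt.covec_comp (h1.comp z (he.contDiffAt hc hz hzc))
    (contDiffAt_complexify (he.contDiffAt_dTrans hc hz hzc))
  refine h2.congr_of_eventuallyEq ?_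
  filter_upwards [eventually_mem_target hz hzc] with w hw
  exact localRep_eq he hc hw.1 hw.2 β

theorem dCoord_chartAt_self (x : X) :
    dCoord (chartAt (Cn n) x) x = ContinuousLinearMap.id ℝ (Cn n) := by
  rw [dCoord_eq (isSmoothCoord_chartAt x) (mem_chart_source _ _),
    dTrans_self (mem_chart_target _ _)]

theorem del_ownCoords (β : KForm n X k) (x : X) :
    del (ownCoords n X) β x = delFlat (localRep (chartAt (Cn n) x) β) (chartAt (Cn n) x x) := by
  rw [del, ownCoords, dCoord_chartAt_self, complexify_id]
  rfl

theorem delbar_ownCoords (β : KForm n X k) (x : X) :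
    delbar (ownCoords n X) β x =
      delbarFlat (localRep (chartAt (Cn n) x) β) (chartAt (Cn n) x x) := by
  rw [delbar, ownCoords, dCoord_chartAt_self, complexify_id]
  rfl

end Charts

theorem delFlat_congr {k : ℕ} {β γ : Cn n → Covec n k} (h : β =ᶠ[𝓝 z] γ) :
    delFlat β z = delFlat γ z := by
  rw [delFlat_eq, delFlat_eq, cderiv_congr h]

end SmoothCoordinates

/-! ### Trivialized families -/

namespace DifferentiableFamily.Trivialization

open Set

variable {n m : ℕ} {B : Opens (EuclideanSpace ℝ (Fin m))} {ι 𝒳 : Type*} [TopologicalSpace 𝒳]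
  [ChartedSpace (Cn n × EuclideanSpace ℝ (Fin m)) 𝒳]
  {F : DifferentiableFamily n B ι 𝒳}
  {X : Type*} [TopologicalSpace X] [ChartedSpace (Cn n) X] (Φ : F.Trivialization X)

theorem isSmoothCoord_coord (t : B) (j : ι) : IsSmoothCoord (Φ.coord t j) where
  contMDiffOn := by
    have h1 : ContMDiff 𝓘(ℝ, Cn n) (𝓘(ℝ, Cn n).prod 𝓘(ℝ, EuclideanSpace ℝ (Fin m))) ∞
        fun x : X => (x, t) := contMDiff_id.prodMk contMDiff_const
    have h2 := Φ.toDiffeo.contMDiff.comp h1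
    have h3 := contMDiffOn_of_mem_maximalAtlas (F.smooth_chart j)
    exact contDiff_fst.contMDiff.comp_contMDiffOn (h3.comp h2.contMDiffOn fun x hx => hx)
  contMDiffOn_symm := by
    have h1 : ContMDiff 𝓘(ℝ, Cn n) 𝓘(ℝ, Cn n × EuclideanSpace ℝ (Fin m)) ∞
        fun z : Cn n => (z, (t : EuclideanSpace ℝ (Fin m))) :=
      (contDiff_id.prodMk contDiff_const).contMDiff
    have h3 := contMDiffOn_symm_of_mem_maximalAtlas (F.smooth_chart j)
    have h4 := Φ.toDiffeo.symm.contMDiff.comp_contMDiffOn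
      (h3.comp (h1.contMDiffOn (s := (Φ.coord t j).target)) fun z hz => hz)
    exact contMDiff_fst.comp_contMDiffOn h4

variable {t : B} {j l : ι} {z : Cn n}

/-- At fixed `t` the trivialization cancels, leaving the fibrewise transition map of the family,
which is holomorphic. -/
theorem wirtBarMat_dTrans_coord (hz : z ∈ (Φ.coord t j).target)
    (hz' : (Φ.coord t j).symm z ∈ (Φ.coord t l).source) :
    wirtBarMat (dTrans (Φ.coord t j) (Φ.coord t l) z) = 0 := by
  have e1 : ∀ w ∈ (Φ.coord t j).target, Φ.toDiffeo ((Φ.coord t j).symm w, t) =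
      (F.chart j).symm (w, (t : EuclideanSpace ℝ (Fin m))) := fun w hw => Φ.symm_mk j w t hw
  have hev := eventually_mem_target hz hz'
  have h1 : DifferentiableAt ℂ
      (fun w : Cn n => (F.chart l ((F.chart j).symm (w, (t : EuclideanSpace ℝ (Fin m))))).1) z := by
    refine (F.holomorphic_transition l j t).differentiableAt ?_
    filter_upwards [hev] with w hw
    refine ⟨hw.1, ?_⟩
    rw [← e1 w hw.1]
    exact hw.2
  have h2 : DifferentiableAt ℂ (fun w => (Φ.coord t l) ((Φ.coord t j).symm w)) z := by
    refine h1.congr_of_eventuallyEq ?_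
    filter_upwards [hev] with w hw
    change (F.chart l (Φ.toDiffeo ((Φ.coord t j).symm w, t))).1 = _
    rw [e1 w hw.1]
  rw [dTrans, h2.fderiv_restrictScalars ℝ]
  exact wirtBarMat_restrictScalars _

theorem isUnit_wirtMat_dTrans_coord (hz : z ∈ (Φ.coord t j).target)
    (hz' : (Φ.coord t j).symm z ∈ (Φ.coord t l).source) :
    IsUnit (wirtMat (dTrans (Φ.coord t j) (Φ.coord t l) z)) :=
  isUnit_wirtMat (Φ.wirtBarMat_dTrans_coord hz hz') (dTrans_comp_dTrans'
    (Φ.isSmoothCoord_coord t j) (Φ.isSmoothCoord_coord t l) hz hz')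

variable [IsManifold 𝓘(ℂ, Cn n) ω X] {e : OpenPartialHomeomorph X (Cn n)}

/-- The coordinate change from a chart of `X` to the holomorphic coordinates of `X_t`. -/
theorem dTrans_coord_eq (he : e ∈ atlas (Cn n) X) (hz : z ∈ e.target)
    (hz' : e.symm z ∈ (Φ.coord t j).source) :
    dTrans e (Φ.coord t j) z =
      (dTrans (Φ.coordsAt t (e.symm z)) (Φ.coord t j) (Φ.coordsAt t (e.symm z) (e.symm z))).comp
        ((dCoord (Φ.coordsAt t (e.symm z)) (e.symm z)).comp (dCoordSymm e z)) := by
  have hs := isSmoothCoord_of_mem_atlas he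
  have hy : e.symm z ∈ (Φ.coordsAt t (e.symm z)).source := Φ.mem_source_index t _
  have hζ : IsSmoothCoord (Φ.coordsAt t (e.symm z)) := Φ.isSmoothCoord_coord t _
  rw [dCoord_eq hζ hy, dCoordSymm_eq hs hz, ← dTrans_comp hs (isSmoothCoord_chartAt _) hζ hz
    (mem_chart_source _ _) hy, ← dTrans_comp hs hζ (Φ.isSmoothCoord_coord t j) hz hy hz']

theorem wirtBarMat_dCoordSymm (he : e ∈ atlas (Cn n) X) (hz : z ∈ e.target) :
    wirtBarMat (dCoordSymm e z) = 0 := by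
  rw [dCoordSymm_eq (isSmoothCoord_of_mem_atlas he) hz]
  exact wirtBarMat_dTrans he (chart_mem_atlas _ _) hz (mem_chart_source _ _)

theorem isUnit_wirtMat_dCoordSymm (he : e ∈ atlas (Cn n) X) (hz : z ∈ e.target) :
    IsUnit (wirtMat (dCoordSymm e z)) := by
  rw [dCoordSymm_eq (isSmoothCoord_of_mem_atlas he) hz]
  exact isUnit_wirtMat_dTrans he (chart_mem_atlas _ _) hz (mem_chart_source _ _)

/-- The right side involves the chosen coordinates of `X_t` and the preferred chart, both possibly
jumping with `z`. The left side keeps `e` and `j` fixed, hence is smooth in `z` where `∂ζ/∂z` is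
invertible. -/
theorem beltramiMat_dTrans_coord (he : e ∈ atlas (Cn n) X) (hz : z ∈ e.target)
    (hz' : e.symm z ∈ (Φ.coord t j).source) :
    beltramiMat (dTrans e (Φ.coord t j) z) =
      beltramiMat ((dCoord (Φ.coordsAt t (e.symm z)) (e.symm z)).comp (dCoordSymm e z)) := by
  have hy : e.symm z ∈ (Φ.coordsAt t (e.symm z)).source := Φ.mem_source_index t _
  have h0 : (Φ.coordsAt t (e.symm z)).symm (Φ.coordsAt t (e.symm z) (e.symm z)) = e.symm z :=
    (Φ.coordsAt t (e.symm z)).left_inv hy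
  have h1 := (Φ.coordsAt t (e.symm z)).map_source hy
  rw [Φ.dTrans_coord_eq he hz hz', beltramiMat_comp_left]
  · exact Φ.wirtBarMat_dTrans_coord h1 (by rw [← h0] at hz'; exact hz')
  · exact Φ.isUnit_wirtMat_dTrans_coord h1 (by rw [← h0] at hz'; exact hz')

theorem isUnit_wirtMat_dTrans_of_isUnit_dzeta_dz (he : e ∈ atlas (Cn n) X) (hz : z ∈ e.target)
    (hz' : e.symm z ∈ (Φ.coord t j).source) (hu : IsUnit (Φ.dzeta_dz t (e.symm z))) :
    IsUnit (wirtMat (dTrans e (Φ.coord t j) z)) := by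
  have hy : e.symm z ∈ (Φ.coordsAt t (e.symm z)).source := Φ.mem_source_index t _
  have h0 : (Φ.coordsAt t (e.symm z)).symm (Φ.coordsAt t (e.symm z) (e.symm z)) = e.symm z :=
    (Φ.coordsAt t (e.symm z)).left_inv hy
  have h1 := (Φ.coordsAt t (e.symm z)).map_source hy
  rw [Φ.dTrans_coord_eq he hz hz']
  refine isUnit_wirtMat_comp_left ?_ ?_ (isUnit_wirtMat_comp_right
    (wirtBarMat_dCoordSymm he hz) (isUnit_wirtMat_dCoordSymm he hz) hu)
  · exact Φ.wirtBarMat_dTrans_coord h1 (by rw [← h0] at hz'; exact hz')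
  · exact Φ.isUnit_wirtMat_dTrans_coord h1 (by rw [← h0] at hz'; exact hz')

/-! ### Local expressions of the extension map and of the contractions -/

variable {k : ℕ} (β : KForm n X k)

theorem localRep_extendForm (he : e ∈ atlas (Cn n) X) (hz : z ∈ e.target)
    (hz' : e.symm z ∈ (Φ.coord t j).source) :
    localRep e (extendForm (Φ.beltrami t) β) z =
      extend (beltramiMat (dTrans e (Φ.coord t j) z)) (localRep e β z) := by
  rw [Φ.beltramiMat_dTrans_coord he hz hz']
  exact extend_compContinuousLinearMap (wirtBarMat_dCoordSymm he hz)
    (isUnit_wirtMat_dCoordSymm he hz) _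

theorem localRep_simulForm (he : e ∈ atlas (Cn n) X) (hz : z ∈ e.target)
    (hz' : e.symm z ∈ (Φ.coord t j).source) :
    localRep e (simulForm (Φ.beltrami t) β) z =
      simul (1 - (tensorBar (beltramiMat (dTrans e (Φ.coord t j) z))).comp
        (tensor (beltramiMat (dTrans e (Φ.coord t j) z)))) (localRep e β z) := by
  rw [Φ.beltramiMat_dTrans_coord he hz hz']
  exact simul_compContinuousLinearMap (wirtBarMat_dCoordSymm he hz)
    (isUnit_wirtMat_dCoordSymm he hz) _

theorem localRep_contractForm (he : e ∈ atlas (Cn n) X) (hz : z ∈ e.target)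
    (hz' : e.symm z ∈ (Φ.coord t j).source) :
    localRep e (contractForm (Φ.beltrami t) β) z =
      contract (tensor (beltramiMat (dTrans e (Φ.coord t j) z))) (localRep e β z) := by
  rw [Φ.beltramiMat_dTrans_coord he hz hz']
  exact contract_tensor_compContinuousLinearMap (wirtBarMat_dCoordSymm he hz)
    (isUnit_wirtMat_dCoordSymm he hz) _

variable {β}

theorem isSmooth_extendForm (hu : ∀ x, IsUnit (Φ.dzeta_dz t x)) (hβ : IsSmooth β) :
    IsSmooth (extendForm (Φ.beltrami t) β) := by
  intro e he z hz
  have hs := isSmoothCoord_of_mem_atlas he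
  have hz' := Φ.mem_source_index t (e.symm z)
  refine ContDiffAt.contDiffWithinAt ?_
  refine (contDiffAt_extend (hs.contDiffAt_dTrans (Φ.isSmoothCoord_coord t _) hz hz')
    (Φ.isUnit_wirtMat_dTrans_of_isUnit_dzeta_dz he hz hz' (hu _))
    (hβ.contDiffAt_localRep hs hz)).congr_of_eventuallyEq ?_
  filter_upwards [eventually_mem_target hz hz'] with w hw
  exact Φ.localRep_extendForm β he hw.1 hw.2

/-- The pullback to `X` of the expression of `e^{i_φ|i_φ̄} β` in holomorphic coordinates of
`X_t`. -/
theorem localRep_coord_extendForm (he : e ∈ atlas (Cn n) X) (hz : z ∈ e.target)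
    (hz' : e.symm z ∈ (Φ.coord t j).source) :
    (localRep (Φ.coord t j) (extendForm (Φ.beltrami t) β)
        (Φ.coord t j (e.symm z))).compContinuousLinearMap
        (complexify (dTrans e (Φ.coord t j) z)) =
      extend (beltramiMat (dTrans e (Φ.coord t j) z)) (localRep e β z) := by
  rw [← Φ.localRep_extendForm β he hz hz', localRep_eq (isSmoothCoord_of_mem_atlas he)
    (Φ.isSmoothCoord_coord t j) hz hz']

theorem isPQForm_extendForm (hu : ∀ x, IsUnit (Φ.dzeta_dz t x)) {p q : ℕ}
    (hβ : IsPQForm (ownCoords n X) p q β) :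
    IsPQForm (Φ.coordsAt t) p q (extendForm (Φ.beltrami t) β) := by
  refine ⟨Φ.isSmooth_extendForm hu hβ.1, fun x => ?_⟩
  have hc := isSmoothCoord_chartAt (n := n) x
  have hz := mem_chart_target (Cn n) x
  have h0 : (chartAt (Cn n) x).symm (chartAt (Cn n) x x) = x :=
    (chartAt (Cn n) x).left_inv (mem_chart_source _ _)
  have hz' : (chartAt (Cn n) x).symm (chartAt (Cn n) x x) ∈
      (Φ.coord t (Φ.index t x)).source := by rw [h0]; exact Φ.mem_source_index t x
  have h := Φ.localRep_coord_extendForm (β := β) (chart_mem_atlas _ x) hz hz'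
  have ht := isType_of_comp_complexify
    (Φ.isUnit_wirtMat_dTrans_of_isUnit_dzeta_dz (chart_mem_atlas _ x) hz hz' (hu _))
    (dTrans_comp_dTrans hc (Φ.isSmoothCoord_coord t _) hz hz') (hβ.2 x) h
  rwa [h0] at ht

/-- Near `x` the preferred chart and a single `ζ` are fixed. All operators then become flat ones,
and `delbarFlat_eq_zero_iff` applies to `f = ζ ∘ c⁻¹`. -/
theorem delbar_extendForm_apply_eq_zero_iff (hu : ∀ x, IsUnit (Φ.dzeta_dz t x))
    (hβ : IsSmooth β) (x : X) :
    delbar (Φ.coordsAt t) (extendForm (Φ.beltrami t) β) x = 0 ↔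
      del (ownCoords n X) (contractForm (Φ.beltrami t) (simulForm (Φ.beltrami t) β)) x
        - contract (tensor (Φ.beltrami t x))
          (del (ownCoords n X) (simulForm (Φ.beltrami t) β) x)
        + delbar (ownCoords n X) (simulForm (Φ.beltrami t) β) x = 0 := by
  set c := chartAt (Cn n) x with hcdef
  set ζ := Φ.coord t (Φ.index t x) with hζdef
  have hmem : c ∈ atlas (Cn n) X := chart_mem_atlas _ x
  have hc : IsSmoothCoord c := isSmoothCoord_chartAt x
  have hζ : IsSmoothCoord ζ := Φ.isSmoothCoord_coord t _
  have hz : c x ∈ c.target := mem_chart_target (Cn n) x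
  have hx : x ∈ ζ.source := Φ.mem_source_index t x
  have h0 : c.symm (c x) = x := c.left_inv (mem_chart_source _ _)
  have hz' : c.symm (c x) ∈ ζ.source := by rw [h0]; exact hx
  have hev := eventually_mem_target hz hz'
  have hD : dCoord ζ x = dTrans c ζ (c x) := dCoord_eq hζ hx
  have hφ : Φ.beltrami t x = beltramiMat (dTrans c ζ (c x)) := congrArg beltramiMat hD
  have hinv := dTrans_comp_dTrans' hc hζ hz hz'
  have key := delbarFlat_eq_zero_iff (f := fun w => ζ (c.symm w)) (z₀ := c x)
    (α := localRep c β) (β := localRep c (simulForm (Φ.beltrami t) β))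
    (γ := localRep ζ (extendForm (Φ.beltrami t) β))
    (hc.contDiffAt hζ hz hz')
    (hev.mono fun w hw => Φ.isUnit_wirtMat_dTrans_of_isUnit_dzeta_dz hmem hw.1 hw.2 (hu _))
    (hev.mono fun w hw => ⟨_, dTrans_comp_dTrans hc hζ hw.1 hw.2⟩)
    (((Φ.isSmooth_extendForm hu hβ).contDiffAt_localRep hζ
      (ζ.map_source hz')).differentiableAt (by simp))
    (hev.mono fun w hw => Φ.localRep_coord_extendForm hmem hw.1 hw.2)
    (hev.mono fun w hw => Φ.localRep_simulForm β hmem hw.1 hw.2)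
  have hdel : delFlat (localRep c (contractForm (Φ.beltrami t) (simulForm (Φ.beltrami t) β)))
      (c x) = delFlat (fun w => contract (tensor (beltramiMat (dTrans c ζ w)))
        (localRep c (simulForm (Φ.beltrami t) β) w)) (c x) :=
    delFlat_congr (hev.mono fun w hw => Φ.localRep_contractForm _ hmem hw.1 hw.2)
  rw [del_ownCoords, del_ownCoords, delbar_ownCoords, hφ, hdel]
  refine Iff.trans ?_ key
  have hd : delbar (Φ.coordsAt t) (extendForm (Φ.beltrami t) β) x =
      (delbarFlat (localRep ζ (extendForm (Φ.beltrami t) β)) (ζ x)).compContinuousLinearMap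
        (complexify (dTrans c ζ (c x))) := by
    rw [← hD]; rfl
  rw [hd, h0]
  -- `∂̄_t` is expressed in the frame of `X_0` through the invertible complexified differential of
  -- `ζ`, so vanishing can be tested in the coordinates `ζ`.
  refine ⟨fun h => compContinuousLinearMap_injective (A := complexify (dTrans c ζ (c x)))
    (fun w => ⟨_, complexify_leftInverse hinv w⟩) (h.trans rfl), fun h => by rw [h]; rfl⟩

end DifferentiableFamily.Trivialization

/-! ### Invertibility of `∂ζ/∂z` for small `t` -/

namespace DifferentiableFamily.Trivialization

open Set

variable {n m : ℕ} {B : Opens (EuclideanSpace ℝ (Fin m))} {ι 𝒳 : Type*} [TopologicalSpace 𝒳]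
  [ChartedSpace (Cn n × EuclideanSpace ℝ (Fin m)) 𝒳]
  {F : DifferentiableFamily n B ι 𝒳}
  {X : Type*} [TopologicalSpace X] [ChartedSpace (Cn n) X] [IsManifold 𝓘(ℂ, Cn n) ω X]
  (Φ : F.Trivialization X)

/-- At `t = 0` the coordinates are holomorphic on `X`, so the differential is complex linear; being
invertible, it has an invertible matrix `∂ζ/∂z`. -/
theorem isUnit_wirtMat_dTrans_base {x : X} {j : ι} (hx : x ∈ (Φ.coord F.base j).source) :
    IsUnit (wirtMat (dTrans (chartAt (Cn n) x) (Φ.coord F.base j) (chartAt (Cn n) x x))) := by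
  have h0 : (chartAt (Cn n) x).symm (chartAt (Cn n) x x) = x :=
    (chartAt (Cn n) x).left_inv (mem_chart_source _ _)
  have hz := mem_chart_target (Cn n) x
  have hz' : (chartAt (Cn n) x).symm (chartAt (Cn n) x x) ∈ (Φ.coord F.base j).source := by
    rwa [h0]
  refine isUnit_wirtMat ?_ (dTrans_comp_dTrans' (isSmoothCoord_chartAt x)
    (Φ.isSmoothCoord_coord _ _) hz hz')
  have h1 : MDifferentiableAt 𝓘(ℂ, Cn n) 𝓘(ℂ, Cn n) (Φ.coord F.base j)
      ((chartAt (Cn n) x).symm (chartAt (Cn n) x x)) :=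
    (Φ.holomorphic_base j).mdifferentiableAt ((Φ.coord F.base j).open_source.mem_nhds hz')
  have h2 : MDifferentiableAt 𝓘(ℂ, Cn n) 𝓘(ℂ, Cn n) (chartAt (Cn n) x).symm
      (chartAt (Cn n) x x) :=
    ((contMDiffOn_chart_symm (I := 𝓘(ℂ, Cn n)) (n := ω)).contMDiffAt
      ((chartAt (Cn n) x).open_target.mem_nhds hz)).mdifferentiableAt (by simp)
  have h3 : DifferentiableAt ℂ (fun w => (Φ.coord F.base j) ((chartAt (Cn n) x).symm w))
      (chartAt (Cn n) x x) := mdifferentiableAt_iff_differentiableAt.1 (h1.comp _ h2)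
  rw [dTrans, h3.fderiv_restrictScalars ℝ]
  exact wirtBarMat_restrictScalars _

/-- Invertibility of `∂ζ/∂z` is independent of the holomorphic coordinates on both sides, so it may
be tested with a fixed chart `e` and a fixed index `j`. -/
theorem isUnit_dzeta_dz_of_isUnit_wirtMat_dTrans {e : OpenPartialHomeomorph X (Cn n)} {t : B}
    {j : ι} {x : X} (he : e ∈ atlas (Cn n) X) (hx : x ∈ e.source)
    (hx' : x ∈ (Φ.coord t j).source) (hu : IsUnit (wirtMat (dTrans e (Φ.coord t j) (e x)))) :
    IsUnit (Φ.dzeta_dz t x) := by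
  set c := chartAt (Cn n) x
  set ζ := Φ.coord t (Φ.index t x)
  have hc : IsSmoothCoord c := isSmoothCoord_chartAt x
  have hs := isSmoothCoord_of_mem_atlas he
  have hζ : IsSmoothCoord ζ := Φ.isSmoothCoord_coord t _
  have hj : IsSmoothCoord (Φ.coord t j) := Φ.isSmoothCoord_coord t j
  have hxζ : x ∈ ζ.source := Φ.mem_source_index t x
  have hxc : x ∈ c.source := mem_chart_source _ _
  have h0 : c.symm (c x) = x := c.left_inv hxc
  have h1 : e.symm (e x) = x := e.left_inv hx
  have h2 : (Φ.coord t j).symm (Φ.coord t j x) = x := (Φ.coord t j).left_inv hx'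
  have hd : dCoord ζ x = (dTrans (Φ.coord t j) ζ (Φ.coord t j x)).comp
      ((dTrans e (Φ.coord t j) (e x)).comp (dTrans c e (c x))) := by
    rw [dCoord_eq hζ hxζ, dTrans_comp hc hj hζ (c.map_source hxc) (by rwa [h0]) (by rwa [h0]),
      dTrans_comp hc hs hj (c.map_source hxc) (by rwa [h0]) (by rwa [h0]), h0]
  change IsUnit (wirtMat (dCoord ζ x))
  rw [hd]
  refine isUnit_wirtMat_comp_left ?_ ?_ (isUnit_wirtMat_comp_right ?_ ?_ hu)
  · exact Φ.wirtBarMat_dTrans_coord ((Φ.coord t j).map_source hx') (by rwa [h2])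
  · exact Φ.isUnit_wirtMat_dTrans_coord ((Φ.coord t j).map_source hx') (by rwa [h2])
  · exact wirtBarMat_dTrans (chart_mem_atlas _ x) he (c.map_source hxc) (by rwa [h0])
  · exact isUnit_wirtMat_dTrans (chart_mem_atlas _ x) he (c.map_source hxc) (by rwa [h0])

/-- The differentials of the holomorphic coordinates of `X_t` are continuous in `t`. -/
theorem continuousAt_dTrans_coord {x : X} {t : B} {j : ι} (hx : x ∈ (Φ.coord t j).source) :
    ContinuousAt (fun p : B × X => dTrans (chartAt (Cn n) x) (Φ.coord p.1 j)
      (chartAt (Cn n) x p.2)) (t, x) := by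
  set c := chartAt (Cn n) x with hcdef
  have hc : IsSmoothCoord c := isSmoothCoord_chartAt x
  have hxc : x ∈ c.source := mem_chart_source _ _
  -- A chart of `B` turns `ζ_j(z, t)` into a function `g` on a vector space, jointly smooth near the
  -- point; `dTrans` is then its partial derivative in `z`.
  set b := chartAt (EuclideanSpace ℝ (Fin m)) t with hbdef
  have hb : ∀ s ∈ b.source, b s = s := fun s _ => rfl
  have htb : t ∈ b.source := mem_chart_source _ _
  set g : Cn n × EuclideanSpace ℝ (Fin m) → Cn n := fun p =>
    (F.chart j (Φ.toDiffeo (c.symm p.1, b.symm p.2))).1 with hgdef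
  have h0 : (c.symm (c x), b.symm (b t)) = (x, t) := by
    rw [c.left_inv hxc, b.left_inv htb]
  have hg : ContDiffAt ℝ ∞ g (c x, b t) := by
    have h1 : ContMDiffAt 𝓘(ℝ, Cn n × EuclideanSpace ℝ (Fin m)) 𝓘(ℝ, Cn n) ∞
        (fun p : Cn n × EuclideanSpace ℝ (Fin m) => c.symm p.1) (c x, b t) :=
      ContMDiffAt.comp (g := c.symm) (c x, b t)
        (hc.contMDiffOn_symm.contMDiffAt (c.open_target.mem_nhds (c.map_source hxc)))
        contDiff_fst.contMDiff.contMDiffAt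
    have h2 : ContMDiffAt 𝓘(ℝ, Cn n × EuclideanSpace ℝ (Fin m)) 𝓘(ℝ, EuclideanSpace ℝ (Fin m)) ∞
        (fun p : Cn n × EuclideanSpace ℝ (Fin m) => b.symm p.2) (c x, b t) :=
      ContMDiffAt.comp (g := b.symm) (c x, b t)
        ((contMDiffOn_chart_symm (I := 𝓘(ℝ, EuclideanSpace ℝ (Fin m)))
          (n := ∞)).contMDiffAt (b.open_target.mem_nhds (b.map_source htb)))
        contDiff_snd.contMDiff.contMDiffAt
    have h3 := (Φ.toDiffeo.contMDiff (c.symm (c x), b.symm (b t))).comp (c x, b t)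
      (h1.prodMk h2)
    have h4 : ContMDiffAt 𝓘(ℝ, Cn n × EuclideanSpace ℝ (Fin m))
        𝓘(ℝ, Cn n × EuclideanSpace ℝ (Fin m)) ∞ (F.chart j)
        (Φ.toDiffeo (c.symm (c x), b.symm (b t))) := by
      refine (contMDiffOn_of_mem_maximalAtlas (F.smooth_chart j)).contMDiffAt
        ((F.chart j).open_source.mem_nhds ?_)
      rw [h0]; exact hx
    have h5 := contDiff_fst.contMDiff.contMDiffAt.comp (c x, b t) (h4.comp (c x, b t) h3)
    exact contMDiffAt_iff_contDiffAt.1 h5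
  have hcb : ContinuousAt (fun p : B × X => (c p.2, b p.1)) (t, x) :=
    ContinuousAt.prodMk ((c.continuousAt hxc).comp (f := Prod.snd) (x := (t, x)) continuousAt_snd)
      ((b.continuousAt htb).comp (f := Prod.fst) (x := (t, x)) continuousAt_fst)
  have hdiff : ∀ᶠ p in 𝓝 (c x, b t), DifferentiableAt ℝ g p :=
    ((hg.of_le (m := 1) (by exact_mod_cast le_top)).eventually (by simp)).mono
      fun p hp => hp.differentiableAt (by norm_num)
  have hcont : ContinuousAt (fun p => (fderiv ℝ g p).comp
      (ContinuousLinearMap.inl ℝ (Cn n) (EuclideanSpace ℝ (Fin m)))) (c x, b t) :=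
    ((hg.fderiv_right (m := 0) (by simp)).continuousAt).clm_comp continuousAt_const
  have hmem : ∀ᶠ p : B × X in 𝓝 (t, x), p.1 ∈ b.source :=
    continuousAt_fst.eventually (b.open_source.eventually_mem htb)
  have hcomp := ContinuousAt.comp (f := fun p : B × X => (c p.2, b p.1)) (x := (t, x)) hcont hcb
  refine hcomp.congr ?_
  filter_upwards [hmem, hcb.eventually hdiff] with p hp hd
  have he : (fun w => (Φ.coord p.1 j) (c.symm w)) = fun w => g (w, b p.1) := by
    funext w
    simp only [hgdef, b.left_inv hp]
    rfl
  have h6 : HasFDerivAt (fun w : Cn n => (w, b p.1))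
      (ContinuousLinearMap.inl ℝ (Cn n) (EuclideanSpace ℝ (Fin m))) (c p.2) :=
    hasFDerivAt_prodMk_left _ _
  rw [dTrans, he]
  exact (HasFDerivAt.comp (c p.2) hd.hasFDerivAt h6).fderiv.symm

theorem eventually_isUnit_dzeta_dz [CompactSpace X] :
    ∀ᶠ t in 𝓝 F.base, ∀ x, IsUnit (Φ.dzeta_dz t x) := by
  suffices h : ∀ᶠ t in 𝓝 F.base, ∀ x ∈ (univ : Set X), IsUnit (Φ.dzeta_dz t x) from
    h.mono fun t ht x => ht x (mem_univ x)
  refine isCompact_univ.eventually_forall_of_forall_eventually fun x _ => ?_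
  set c := chartAt (Cn n) x with hcdef
  -- The index is frozen at its value for `(0, x)`: the chosen index at nearby `(t, x')` may jump,
  -- but the determinant for `ζ_j` is continuous.
  set j := Φ.index F.base x
  have hx : x ∈ (Φ.coord F.base j).source := Φ.mem_source_index F.base x
  have hcont := Φ.continuousAt_dTrans_coord hx
  have hdet : Continuous fun L : Cn n →L[ℝ] Cn n => (wirtMat L).det :=
    continuous_iff_continuousAt.2 fun L =>
      (contDiffAt_det fun a b => contDiffAt_wirtMat contDiffAt_id a b).continuousAt
  have h1 : (wirtMat (dTrans c (Φ.coord F.base j) (c x))).det ≠ 0 :=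
    ((Matrix.isUnit_iff_isUnit_det _).1 (Φ.isUnit_wirtMat_dTrans_base hx)).ne_zero
  have h2 : ∀ᶠ p : B × X in 𝓝 (F.base, x),
      (wirtMat (dTrans c (Φ.coord p.1 j) (c p.2))).det ≠ 0 :=
    (hdet.continuousAt.comp hcont).eventually_ne h1
  have h3 : ∀ᶠ p : B × X in 𝓝 (F.base, x), p.2 ∈ c.source :=
    continuousAt_snd.eventually (c.open_source.eventually_mem (mem_chart_source _ _))
  have h4 : ∀ᶠ p : B × X in 𝓝 (F.base, x), Φ.toDiffeo (p.2, p.1) ∈ (F.chart j).source :=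
    (Φ.toDiffeo.continuous.comp continuous_swap).continuousAt.eventually
      ((F.chart j).open_source.eventually_mem hx)
  filter_upwards [h2, h3, h4] with p hp2 hp3 hp4
  exact Φ.isUnit_dzeta_dz_of_isUnit_wirtMat_dTrans (chart_mem_atlas _ x) hp3 hp4
    ((Matrix.isUnit_iff_isUnit_det _).2 (isUnit_iff_ne_zero.2 hp2))

end DifferentiableFamily.Trivialization

end Deformation

end

/-! ### The theorem -/

open Deformation in
theorem proposition2p12 {n m : ℕ} {B : Opens (EuclideanSpace ℝ (Fin m))} {ι 𝒳 : Type*}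
    [TopologicalSpace 𝒳] [T2Space 𝒳] [SecondCountableTopology 𝒳]
    [ChartedSpace (Cn n × EuclideanSpace ℝ (Fin m)) 𝒳]
    [IsManifold 𝓘(ℝ, Cn n × EuclideanSpace ℝ (Fin m)) ∞ 𝒳]
    (F : DifferentiableFamily n B ι 𝒳)
    {X : Type*} [TopologicalSpace X] [T2Space X] [CompactSpace X] [ConnectedSpace X]
    [ChartedSpace (Cn n) X] [IsManifold 𝓘(ℂ, Cn n) ω X]
    (Φ : F.Trivialization X) :
    ∀ᶠ t in 𝓝 F.base,
      (∀ x, IsUnit (Φ.dzeta_dz t x)) ∧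
      (∀ (p q : ℕ) (σ : KForm n X (p + q)), IsPQForm (ownCoords n X) p q σ →
        IsPQForm (Φ.coordsAt t) p q (extendForm (Φ.beltrami t) σ)) ∧
      ∀ (k : ℕ) (α : KForm n X k), IsSmooth α →
        (delbar (Φ.coordsAt t) (extendForm (Φ.beltrami t) α) = 0 ↔
          del (ownCoords n X) (contractForm (Φ.beltrami t) (simulForm (Φ.beltrami t) α))
            - contractForm (Φ.beltrami t) (del (ownCoords n X) (simulForm (Φ.beltrami t) α))
            + delbar (ownCoords n X) (simulForm (Φ.beltrami t) α) = 0) := by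
  filter_upwards [Φ.eventually_isUnit_dzeta_dz] with t ht
  refine ⟨ht, fun p q σ hσ => Φ.isPQForm_extendForm ht hσ, fun k α hα => ?_⟩
  rw [funext_iff, funext_iff]
  exact forall_congr' fun x => Φ.delbar_extendForm_apply_eq_zero_iff ht hα x
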